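/- Let $\alpha\in(0,1)$. For $\tau\in(-1,0]$ put $$c_\alpha(\tau)=\int_0^{\infty}\frac{|1-t|^\tau+(1+t)^\tau-2}{t^{1+2\alpha}}\,dt .$$ There are a number $\alpha_0\in(0,1)$ and a function $\tau_1:(0,\alpha_0)\to(-1,0)$, uniquely determined by the following: $c_\alpha>0$ on $(-1,0)$ for $\alpha\in[\alpha_0,1)$; and for $\alpha\in(0,\alpha_0)$, $c_\alpha>0$ on $(-1,\tau_1(\alpha))$, $c_\alpha(\tau_1(\alpha))=0$, and $c_\alpha<0$ on $(\tau_1(\alpha),0)$. With these $\alpha_0$ and $\tau_1$ the following holds. Let $\Omega\subset\mathbb R^N$ be a bounded domain (open and connected) with $C^2$ boundary, and let $\mathcal C\subset\Omega$ be a compact embedded $(N-1)$-dimensional $C^2$ submanifold without boundary such that $\Omega\setminus\mathcal C$ has exactly two connected components $\Omega_1,\Omega_2$, with $\overline{\Omega}_1\cap\partial\Omega=\emptyset$ and $\overline{\Omega}_2\cap\partial\Omega=\partial\Omega$. Write $D(x)=\operatorname{dist}(x,\mathcal C)$, $d(x)=\operatorname{dist}(x,\partial\Omega)$, $A_\delta=\{x\in\Omega: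 D(x)<\delta\}$ and $B_\delta=\{x\in\Omega: d(x)<\delta\}$. Let $\delta>0$ be such that $D$ is $C^2$ in $A_\delta\setminus\mathcal C$, $d$ is $C^2$ in $B_\delta$, and $\operatorname{dist}(A_\delta,B_\delta)>0$. For $\tau\in(-1,0)$ let $$V_\tau(x)=\begin{cases}D(x)^\tau, & x\in A_\delta\setminus\mathcal C,\\ d(x)^2, & x\in B_\delta,\\ l(x), & x\in\Omega\setminus(A_\delta\cup B_\delta),\\ 0, & x\in\mathbb R^N\setminus\Omega,\end{cases}$$ where $l$ is any positive function such that $V_\tau$ is of class $C^2$ in $\Omega\setminus\mathcal C$. For $x\in\Omega\setminus\mathcal C$ let $$(-\Delta)^\alpha V_\tau(x)=-\frac12\int_{\mathbb R^N}\frac{V_\tau(x+y)+V_\tau(x-y)-2V_\tau(x)}{|y|^{N+2\alpha}}\,dy .$$ This integral converges absolutely for every $x\in\Omega\setminus\mathcal C$, and: (i) If $(\alpha,\tau)\in[\alpha_0,1)\times(-1,0)$, or $\alpha\in(0,\alpha_0)$ and $\tau\in(-1,\tau_1(\alpha))$, then there exist $\delta_1\in(0,\delta]$ and $C>1$ such that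 $$\frac1C D(x)^{\tau-2\alpha}\le-(-\Delta)^\alpha V_\tau(x)\le C D(x)^{\tau-2\alpha},\qquad x\in A_{\delta_1}\setminus\mathcal C .$$ (ii) If $\alpha\in(0,\alpha_0)$ and $\tau\in(\tau_1(\alpha),0)$, then there exist $\delta_1\in(0,\delta]$ and $C>1$ such that $$\frac1C D(x)^{\tau-2\alpha}\le(-\Delta)^\alpha V_\tau(x)\le C D(x)^{\tau-2\alpha},\qquad x\in A_{\delta_1}\setminus\mathcal C .$$ (iii) If $\alpha\in(0,\alpha_0)$ and $\tau=\tau_1(\alpha)$, then there exist $\delta_1\in(0,\delta]$ and $C>1$ such that $$|(-\Delta)^\alpha V_\tau(x)|\le C D(x)^{\min\{\tau,\,2\tau-2\alpha+1\}},\qquad x\in A_{\delta_1}\setminus\mathcal C .$$ -/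

import Mathlib

open MeasureTheory Set

noncomputable section

namespace InteriorBlowUp

/-- The Euclidean space `ℝ^N`. -/
abbrev E (N : ℕ) : Type := EuclideanSpace ℝ (Fin N)

/-! ### The fractional Laplacian -/

/-- The integrand `δ(u,x,y) / |y|^(N+2α)`, where `δ(u,x,y) = u(x+y) + u(x-y) - 2u(x)`. -/
def fracIntegrand {N : ℕ} (α : ℝ) (u : E N → ℝ) (x y : E N) : ℝ :=
  (u (x + y) + u (x - y) - 2 * u x) / ‖y‖ ^ ((N : ℝ) + 2 * α)

/-- The fractional Laplacian `(-Δ)^α u(x) = -(1/2) ∫ δ(u,x,y) / |y|^(N+2α) dy`. -/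
def fracLaplacian {N : ℕ} (α : ℝ) (u : E N → ℝ) (x : E N) : ℝ :=
  -(1 / 2) * ∫ y, fracIntegrand α u x y

/-! ### The function `c` and its threshold values -/

/-- `c(τ) = ∫_0^∞ (|1-t|^τ + (1+t)^τ - 2) / t^(1+2α) dt`, with its dependence on `α` displayed. -/
def c (α τ : ℝ) : ℝ :=
  ∫ t in Ioi (0 : ℝ), (|1 - t| ^ τ + (1 + t) ^ τ - 2) / t ^ (1 + 2 * α)

/-- `α₀ ∈ (0,1)` and `τ₁ : (0,α₀) → (-1,0)` are the values at which the sign of `c` changes.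
These conditions determine `α₀`, and they determine `τ₁` on `(0,α₀)`; the values of `τ₁`
elsewhere are irrelevant. -/
structure IsThreshold (α₀ : ℝ) (τ₁ : ℝ → ℝ) : Prop where
  alpha_mem : α₀ ∈ Ioo (0 : ℝ) 1
  pos_of_ge : ∀ α ∈ Ico α₀ 1, ∀ τ ∈ Ioo (-1 : ℝ) 0, 0 < c α τ
  tau_mem : ∀ α ∈ Ioo 0 α₀, τ₁ α ∈ Ioo (-1 : ℝ) 0
  pos_of_lt : ∀ α ∈ Ioo 0 α₀, ∀ τ ∈ Ioo (-1 : ℝ) (τ₁ α), 0 < c α τ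
  zero : ∀ α ∈ Ioo 0 α₀, c α (τ₁ α) = 0
  neg_of_gt : ∀ α ∈ Ioo 0 α₀, ∀ τ ∈ Ioo (τ₁ α) 0, c α τ < 0

/-- The threshold values are determined by their defining conditions. -/
theorem IsThreshold.unique {α₀ β₀ : ℝ} {τ₁ σ₁ : ℝ → ℝ} (h : IsThreshold α₀ τ₁)
    (k : IsThreshold β₀ σ₁) : α₀ = β₀ ∧ ∀ α ∈ Ioo 0 α₀, τ₁ α = σ₁ α := by
  have aux : ∀ {a b : ℝ} {t s : ℝ → ℝ}, IsThreshold a t → IsThreshold b s → b ≤ a := by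
    intro a b t s h k
    by_contra hab
    push Not at hab
    have ha : a ∈ Ioo 0 b := ⟨h.alpha_mem.1, hab⟩
    have hs := k.tau_mem a ha
    obtain ⟨τ, h1, h2⟩ := exists_between hs.2
    have e1 := k.neg_of_gt a ha τ ⟨h1, h2⟩
    have e2 := h.pos_of_ge a ⟨le_refl a, h.alpha_mem.2⟩ τ ⟨hs.1.trans h1, h2⟩
    exact absurd e1 (not_lt.mpr e2.le)
  have hab : α₀ = β₀ := le_antisymm (aux k h) (aux h k)
  subst hab
  refine ⟨rfl, fun α hα => ?_⟩
  rcases lt_trichotomy (τ₁ α) (σ₁ α) with hlt | heq | hgt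
  · have e := k.pos_of_lt α hα (τ₁ α) ⟨(h.tau_mem α hα).1, hlt⟩
    rw [h.zero α hα] at e
    exact absurd e (lt_irrefl 0)
  · exact heq
  · have e := h.pos_of_lt α hα (σ₁ α) ⟨(k.tau_mem α hα).1, hgt⟩
    rw [k.zero α hα] at e
    exact absurd e (lt_irrefl 0)

/-! ### The domain `Ω` and the hypersurface `𝒞` -/

/-- The boundary of `Ω` is of class `C²`: near each of its points, `Ω` is a sublevel set of a
`C²` function with non-vanishing derivative. -/
def HasC2Boundary {N : ℕ} (Ω : Set (E N)) : Prop :=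
  ∀ x ∈ frontier Ω, ∃ (U : Set (E N)) (ψ : E N → ℝ), IsOpen U ∧ x ∈ U ∧
    ContDiffOn ℝ 2 ψ U ∧ ψ x = 0 ∧ fderiv ℝ ψ x ≠ 0 ∧ Ω ∩ U = {y ∈ U | ψ y < 0}

/-- `S` is an embedded `(N-1)`-dimensional `C²` submanifold of `ℝ^N` without boundary: near each
of its points it is the zero set of a `C²` function with non-vanishing derivative. -/
def IsC2Hypersurface {N : ℕ} (S : Set (E N)) : Prop :=
  ∀ x ∈ S, ∃ (U : Set (E N)) (φ : E N → ℝ), IsOpen U ∧ x ∈ U ∧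
    ContDiffOn ℝ 2 φ U ∧ fderiv ℝ φ x ≠ 0 ∧ S ∩ U = {y ∈ U | φ y = 0}

/-- The geometric setting: `Ω` is a bounded `C²` domain, and `𝒞 ⊆ Ω` is a compact `C²`
hypersurface without boundary such that `Ω \ 𝒞` has exactly two connected components, an inner
one `Ω₁` and an outer one `Ω₂`. -/
structure IsSetting {N : ℕ} (Ω 𝒞 Ω₁ Ω₂ : Set (E N)) : Prop where
  isOpen : IsOpen Ω
  isConnected : IsConnected Ω
  isBounded : Bornology.IsBounded Ω
  boundary : HasC2Boundary Ω
  subset : 𝒞 ⊆ Ω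
  isCompact : IsCompact 𝒞
  hypersurface : IsC2Hypersurface 𝒞
  union : Ω₁ ∪ Ω₂ = Ω \ 𝒞
  disjoint : Disjoint Ω₁ Ω₂
  isOpen_inner : IsOpen Ω₁
  isOpen_outer : IsOpen Ω₂
  isConnected_inner : IsConnected Ω₁
  isConnected_outer : IsConnected Ω₂
  inner : closure Ω₁ ∩ frontier Ω = ∅
  outer : closure Ω₂ ∩ frontier Ω = frontier Ω

/-- `D(x) = dist(x, 𝒞)`. -/
def D {N : ℕ} (𝒞 : Set (E N)) (x : E N) : ℝ := Metric.infDist x 𝒞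

/-- `d(x) = dist(x, ∂Ω)`. -/
def d {N : ℕ} (Ω : Set (E N)) (x : E N) : ℝ := Metric.infDist x (frontier Ω)

/-- `A_δ = {x ∈ Ω | D(x) < δ}`. -/
def A {N : ℕ} (Ω 𝒞 : Set (E N)) (δ : ℝ) : Set (E N) := {x ∈ Ω | D 𝒞 x < δ}

/-- `B_δ = {x ∈ Ω | d(x) < δ}`. -/
def B {N : ℕ} (Ω : Set (E N)) (δ : ℝ) : Set (E N) := {x ∈ Ω | d Ω x < δ}

/-- The width `δ` of the two collars: `D` is `C²` in `A_δ \ 𝒞`, `d` is `C²` in `B_δ`, and the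
two collars are at positive distance from each other. -/
structure IsCollarWidth {N : ℕ} (Ω 𝒞 : Set (E N)) (δ : ℝ) : Prop where
  pos : 0 < δ
  contDiffOn_D : ContDiffOn ℝ 2 (D 𝒞) (A Ω 𝒞 δ \ 𝒞)
  contDiffOn_d : ContDiffOn ℝ 2 (d Ω) (B Ω δ)
  separated : ∃ ε > 0, ∀ x ∈ A Ω 𝒞 δ, ∀ y ∈ B Ω δ, ε ≤ dist x y

/-! ### The function `V_τ` -/

open scoped Classical in
/-- `V_τ` is `D^τ` in `A_δ`, `d²` in `B_δ`, `l` in the rest of `Ω`, and `0` outside `Ω`. (On the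
null set `𝒞` itself the value plays no role.) -/
def V {N : ℕ} (Ω 𝒞 : Set (E N)) (δ : ℝ) (l : E N → ℝ) (τ : ℝ) (x : E N) : ℝ :=
  if x ∈ A Ω 𝒞 δ then D 𝒞 x ^ τ
  else if x ∈ B Ω δ then d Ω x ^ 2
  else if x ∈ Ω then l x
  else 0

/-- `l` is admissible: it is positive on `Ω \ (A_δ ∪ B_δ)` and makes `V_τ` a `C²` function in
`Ω \ 𝒞`. -/
structure IsAdmissible {N : ℕ} (Ω 𝒞 : Set (E N)) (δ τ : ℝ) (l : E N → ℝ) : Prop where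
  pos : ∀ x ∈ Ω \ (A Ω 𝒞 δ ∪ B Ω δ), 0 < l x
  contDiffOn : ContDiffOn ℝ 2 (V Ω 𝒞 δ l τ) (Ω \ 𝒞)

end InteriorBlowUp

end

open Filter Topology

namespace InteriorBlowUp

/-! ### Second order expansions -/

/-! The threshold is explicit: `α₀ = 1/2` and `τ₁ α = 2α - 1`. For fixed `α` the function `c α` is
strictly convex on `(-1, 2α)`, because its integrand is a sum of exponentials in the exponent
(`strictConvexOn_c`). It vanishes at `0` trivially and at `2α - 1` because there the integrand has
an elementary antiderivative (`c_two_mul_sub_one`). Away from `α = 1/2` these are two distinct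
zeros, and convexity fixes the sign everywhere else. At `α = 1/2` they merge; a limit `α ↓ 1/2`
gives `c ≥ 0`, which convexity improves to `c > 0`.

For the estimates, let `ρ = D x > 0` and let `n` be the unit normal at a point of `𝒞` nearest to
`x`, directed towards `x`. Replace `V_τ (x + y)` by `|ρ + ⟨n, y⟩| ^ τ`, a power of the distance to
the tangent hyperplane. Integrating the kernel over hyperplanes orthogonal to `n` reduces the flat
problem to one dimension, and scaling by `ρ` gives exactly `-κ c(τ) ρ^(τ-2α)` with `κ > 0`
(`flat_integral`, `kernelMass_pos`).

The replacement costs `O(ρ^e)`, where `e = min τ (2τ - 2α + 1)` (`lintegral_flatError_le`). For `‖y‖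
< ρ/2` the two distances are comparable to `ρ` and differ by `O(‖y‖²)`, so the mean value theorem
gives `ρ^(τ+1-2α)`. Up to a fixed radius one integrates along lines parallel to `n`. On the line
through a tangential vector `v` the distances differ by at most `ε ~ max(‖v‖, ρ)²`, and the powers
differ in `L¹` by `O(ε^(1+τ))`, although their singularities sit at different points
(`lintegral_rpow_sub_le`). Weighting with the kernel and integrating in `v` yields `ρ^e`. The tail
is bounded. The geometric input, `exists_infDist_expansion`, says that on such lines the distance to
`𝒞` is quadratically close to the flat one and grows at least linearly away from its zero.

The error exceeds the main exponent `τ - 2α` by `min (2α) (τ+1) > 0`. Hence the sign of `c` decides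
(i) and (ii), and for `c = 0` only the error is left, which is (iii). -/

theorem exists_taylor_bound {F : Type*} [NormedAddCommGroup F] [NormedSpace ℝ F] {f : F → ℝ}
    {x : F} (hf : ContDiffAt ℝ 2 f x) :
    ∃ K > 0, ∃ r > 0, ContinuousOn f (Metric.ball x r) ∧
      (∀ p ∈ Metric.ball x r, ∀ q ∈ Metric.ball x r,
        ‖fderiv ℝ f q - fderiv ℝ f p‖ ≤ K * ‖q - p‖) ∧
      ∀ p ∈ Metric.ball x r, ∀ q ∈ Metric.ball x r,
        |f q - f p - fderiv ℝ f p (q - p)| ≤ K * ‖q - p‖ ^ 2 := by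
  have h1 : ContDiffAt ℝ 1 (fderiv ℝ f) x := hf.fderiv_right (by norm_num)
  obtain ⟨K, t, ht, hK⟩ := h1.exists_lipschitzOnWith
  have h2 : ∀ᶠ y in 𝓝 x, ContDiffAt ℝ 2 f y := hf.eventually (by simp)
  obtain ⟨r, hr, hball⟩ := Metric.mem_nhds_iff.1 (inter_mem ht h2)
  have hCD : ∀ y ∈ Metric.ball x r, ContDiffAt ℝ 2 f y := fun y hy => (hball hy).2
  have hKr : ∀ p ∈ Metric.ball x r, ∀ q ∈ Metric.ball x r,
      ‖fderiv ℝ f q - fderiv ℝ f p‖ ≤ (K + 1) * ‖q - p‖ := by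
    intro p hp q hq
    refine (hK.norm_sub_le (hball hq).1 (hball hp).1).trans ?_
    gcongr
    linarith
  refine ⟨K + 1, by positivity, r, hr, ?_, hKr, ?_⟩
  · intro y hy
    exact (hCD y hy).continuousAt.continuousWithinAt
  intro p hp q hq
  -- Intersecting with the closed ball of radius `‖q - p‖` keeps the variation of the derivative
  -- below `(K + 1) * ‖q - p‖`, which makes the final bound quadratic.
  have hconv : Convex ℝ (Metric.ball x r ∩ Metric.closedBall p ‖q - p‖) :=
    (convex_ball x r).inter (convex_closedBall p _)
  have := hconv.norm_image_sub_le_of_norm_hasFDerivWithin_le' (f := f) (f' := fderiv ℝ f)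
    (φ := fderiv ℝ f p) (C := (K + 1) * ‖q - p‖) (x := p) (y := q) ?_ ?_ ?_ ?_
  · rw [Real.norm_eq_abs] at this
    refine this.trans (le_of_eq (by ring))
  · intro y hy
    exact ((hCD y hy.1).differentiableAt
      (by norm_num)).hasFDerivAt.hasFDerivWithinAt
  · intro y hy
    refine (hKr p hp y hy.1).trans ?_
    have : ‖y - p‖ ≤ ‖q - p‖ := by simpa [dist_eq_norm] using hy.2
    gcongr
  · exact ⟨hp, by simp⟩
  · exact ⟨hq, by simp [dist_eq_norm]⟩

theorem exists_second_difference_bound {F : Type*} [NormedAddCommGroup F] [NormedSpace ℝ F]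
    {f : F → ℝ} {x : F} (hf : ContDiffAt ℝ 2 f x) :
    ∃ K > 0, ∃ r > 0, ∀ y, ‖y‖ < r → |f (x + y) + f (x - y) - 2 * f x| ≤ K * ‖y‖ ^ 2 := by
  obtain ⟨K, hK, r, hr, -, -, h⟩ := exists_taylor_bound hf
  refine ⟨2 * K, by positivity, r, hr, fun y hy => ?_⟩
  have h1 := h x (by simpa using hr) (x + y) (by simpa [dist_eq_norm] using hy)
  have h2 := h x (by simpa using hr) (x - y) (by simpa [dist_eq_norm] using hy)
  have e1 : x + y - x = y := by abel
  have e2 : x - y - x = -y := by abel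
  rw [e1] at h1
  rw [e2, map_neg, norm_neg] at h2
  rw [abs_le] at h1 h2 ⊢
  constructor <;> linarith [h1.1, h1.2, h2.1, h2.2]

/-! ### Powers of the absolute value on the line -/

theorem integrableOn_abs_rpow {σ : ℝ} (hσ : -1 < σ) (a : ℝ) :
    IntegrableOn (fun t : ℝ => |t| ^ σ) (Ioo (-a) a) := by
  have h := integrableOn_ball_of_norm_le_rpow (E := ℝ) (μ := volume) (f := fun t : ℝ => |t| ^ σ)
    (C := 1) (α := -σ) (r := a) (by simp) (by simp; linarith)
    (ae_of_all _ fun t => by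
      simp [abs_of_nonneg (Real.rpow_nonneg (abs_nonneg t) σ)])
    (Measurable.aestronglyMeasurable (by fun_prop))
  rwa [Real.ball_eq_Ioo, zero_sub, zero_add] at h

theorem integrableOn_abs_one_sub_rpow {σ : ℝ} (hσ : -1 < σ) (a b : ℝ) :
    IntegrableOn (fun t : ℝ => |1 - t| ^ σ) (Icc a b) := by
  have h := integrableOn_abs_rpow hσ (|a| + |b| + 2)
  have h2 := ((Measure.measurePreserving_sub_left volume (1 : ℝ)).integrableOn_comp_preimage
    (MeasurableEquiv.subLeft (1 : ℝ)).measurableEmbedding).2 h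
  refine IntegrableOn.mono_set h2 ?_
  intro t ht
  have h1 := neg_abs_le a
  have h3 := le_abs_self b
  have h4 := abs_nonneg a
  have h5 := abs_nonneg b
  simp only [mem_preimage, mem_Ioo]
  constructor <;> linarith [ht.1, ht.2]

/-- Near `0` the numerator is a second difference, so the integrand is `O(t^(1-2α))`; at `t = 1` the
condition `σ > -1` suffices; at infinity `σ < 2α` does. -/
theorem integrableOn_c {α σ : ℝ} (hα : α ∈ Ioo (0 : ℝ) 1) (hσ : σ ∈ Ioo (-1) (2 * α)) :
    IntegrableOn (fun t : ℝ => (|1 - t| ^ σ + (1 + t) ^ σ - 2) / t ^ (1 + 2 * α)) (Ioi 0) := by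
  obtain ⟨hα0, hα1⟩ := hα
  obtain ⟨hσ1, hσ2⟩ := hσ
  have hmeas : Measurable (fun t : ℝ => (|1 - t| ^ σ + (1 + t) ^ σ - 2) / t ^ (1 + 2 * α)) := by
    fun_prop
  obtain ⟨K, hK, r, hr, hKr⟩ := exists_second_difference_bound (f := fun s : ℝ => s ^ σ) (x := 1)
    (Real.contDiffAt_rpow_const_of_ne one_ne_zero)
  set η := min (r / 2) (1 / 2) with hη
  have hη0 : 0 < η := by positivity
  have hη1 : η ≤ 1 / 2 := min_le_right _ _
  have hηr : η < r := (min_le_left _ _).trans_lt (by linarith)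
  have e : Ioi (0 : ℝ) = (Ioc 0 η ∪ Icc η 2) ∪ Ioi 2 := by
    rw [Ioc_union_Icc_eq_Ioc hη0 (by linarith), Ioc_union_Ioi_eq_Ioi (by norm_num)]
  rw [e]
  refine (IntegrableOn.union ?_ ?_).union ?_
  · have hi : IntegrableOn (fun t : ℝ => K * t ^ (1 - 2 * α)) (Ioc 0 η) := by
      refine Integrable.const_mul ?_ K
      have := intervalIntegral.intervalIntegrable_rpow' (a := 0) (b := η) (r := 1 - 2 * α)
        (by linarith)
      rwa [intervalIntegrable_iff_integrableOn_Ioc_of_le hη0.le] at this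
    refine Integrable.mono' hi hmeas.aestronglyMeasurable ?_
    filter_upwards [ae_restrict_mem measurableSet_Ioc] with t ht
    have h := hKr t (by rw [Real.norm_eq_abs, abs_of_pos ht.1]; linarith [ht.2])
    have h1 : |1 - t| = 1 - t := abs_of_pos (by linarith [ht.2])
    rw [Real.norm_eq_abs, abs_div, abs_of_pos (Real.rpow_pos_of_pos ht.1 _),
      div_le_iff₀ (Real.rpow_pos_of_pos ht.1 _), h1, mul_assoc, ← Real.rpow_add ht.1]
    have h2 : (1 - 2 * α + (1 + 2 * α)) = (2 : ℕ) := by push_cast; ring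
    rw [h2, Real.rpow_natCast]
    simp only [Real.one_rpow, mul_one, Real.norm_eq_abs, sq_abs] at h
    rwa [add_comm ((1 - t) ^ σ)]
  · have hc : ContinuousOn (fun t : ℝ => (t ^ (1 + 2 * α))⁻¹) (Icc η 2) := by
      refine ContinuousOn.inv₀ ?_ ?_
      · exact ContinuousOn.rpow_const continuousOn_id fun t ht => Or.inl ((hη0.trans_le ht.1).ne')
      · intro t ht
        exact (Real.rpow_pos_of_pos (by linarith [ht.1]) _).ne'
    have h1 : IntegrableOn (fun t : ℝ => |1 - t| ^ σ + ((1 + t) ^ σ - 2)) (Icc η 2) := by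
      refine (integrableOn_abs_one_sub_rpow hσ1 η 2).add ?_
      refine ContinuousOn.integrableOn_Icc ?_
      refine ContinuousOn.sub ?_ continuousOn_const
      exact ContinuousOn.rpow_const (by fun_prop) fun t ht => Or.inl (by linarith [ht.1])
    refine (h1.mul_continuousOn hc isCompact_Icc).congr_fun (fun t _ => ?_) measurableSet_Icc
    simp only [div_eq_mul_inv]
    ring
  -- The truncation at `0` lets `t ^ m` dominate the constant `2` as well as the powers, for either
  -- sign of `σ`.
  · set m := max σ 0 with hm
    have hm0 : 0 ≤ m := le_max_right _ _
    have hmσ : σ ≤ m := le_max_left _ _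
    have hm2 : m < 2 * α := max_lt hσ2 (by linarith)
    have hi : IntegrableOn (fun t : ℝ => (2 ^ m + 3) * t ^ (m - (1 + 2 * α))) (Ioi 2) :=
      (integrableOn_Ioi_rpow_of_lt (by linarith) (by norm_num)).const_mul _
    refine Integrable.mono' hi hmeas.aestronglyMeasurable ?_
    filter_upwards [ae_restrict_mem measurableSet_Ioi] with t ht
    have ht2 : (2 : ℝ) < t := ht
    have ht0 : 0 < t := by linarith
    have h1 : |1 - t| = t - 1 := by rw [abs_of_neg (by linarith)]; ring
    have a1 : |1 - t| ^ σ ≤ t ^ m := by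
      rw [h1]
      exact (Real.rpow_le_rpow_of_exponent_le (by linarith) hmσ).trans
        (Real.rpow_le_rpow (by linarith) (by linarith) hm0)
    have a2 : (1 + t) ^ σ ≤ 2 ^ m * t ^ m := by
      rw [← Real.mul_rpow (by norm_num) ht0.le]
      exact (Real.rpow_le_rpow_of_exponent_le (by linarith) hmσ).trans
        (Real.rpow_le_rpow (by linarith) (by linarith) hm0)
    have a3 : 1 ≤ t ^ m := Real.one_le_rpow (by linarith) hm0
    have a4 : 0 ≤ |1 - t| ^ σ := Real.rpow_nonneg (abs_nonneg _) _
    have a5 : 0 ≤ (1 + t) ^ σ := Real.rpow_nonneg (by linarith) _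
    have a6 : 0 ≤ 2 ^ m * t ^ m := by positivity
    rw [Real.norm_eq_abs, abs_div, abs_of_pos (Real.rpow_pos_of_pos ht0 _),
      div_le_iff₀ (Real.rpow_pos_of_pos ht0 _), mul_assoc, ← Real.rpow_add ht0, sub_add_cancel,
      abs_le]
    constructor <;> nlinarith

/-! ### The threshold values -/

theorem c_zero_right (α : ℝ) : c α 0 = 0 := by
  norm_num [c]

theorem rpow_convexComb_le {x : ℝ} (hx : 0 < x) {σ₁ σ₂ a b : ℝ} (ha : 0 < a) (hb : 0 < b)
    (hab : a + b = 1) : x ^ (a * σ₁ + b * σ₂) ≤ a * x ^ σ₁ + b * x ^ σ₂ := by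
  have := convexOn_exp.2 (mem_univ (Real.log x * σ₁)) (mem_univ (Real.log x * σ₂)) ha.le hb.le hab
  simp only [smul_eq_mul] at this
  rw [Real.rpow_def_of_pos hx, Real.rpow_def_of_pos hx, Real.rpow_def_of_pos hx]
  convert! this using 2
  ring

theorem rpow_convexComb_lt {x : ℝ} (hx : 0 < x) (hx1 : x ≠ 1) {σ₁ σ₂ a b : ℝ} (hσ : σ₁ ≠ σ₂)
    (ha : 0 < a) (hb : 0 < b) (hab : a + b = 1) :
    x ^ (a * σ₁ + b * σ₂) < a * x ^ σ₁ + b * x ^ σ₂ := by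
  have hl : Real.log x ≠ 0 := Real.log_ne_zero_of_pos_of_ne_one hx hx1
  have := strictConvexOn_exp.2 (mem_univ (Real.log x * σ₁)) (mem_univ (Real.log x * σ₂))
    (by simpa [hl] using hσ) ha hb hab
  simp only [smul_eq_mul] at this
  rw [Real.rpow_def_of_pos hx, Real.rpow_def_of_pos hx, Real.rpow_def_of_pos hx]
  convert! this using 2
  ring

theorem strictConvexOn_c {α : ℝ} (hα : α ∈ Ioo (0 : ℝ) 1) :
    StrictConvexOn ℝ (Ioo (-1) (2 * α)) (c α) := by
  refine ⟨convex_Ioo _ _, ?_⟩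
  intro σ₁ h₁ σ₂ h₂ hσ a b ha hb hab
  have h₃ := convex_Ioo (-1) (2 * α) h₁ h₂ ha.le hb.le hab
  simp only [smul_eq_mul] at h₃ ⊢
  set g : ℝ → ℝ → ℝ := fun σ t => (|1 - t| ^ σ + (1 + t) ^ σ - 2) / t ^ (1 + 2 * α) with hg
  have i₁ : IntegrableOn (fun t => a * g σ₁ t) (Ioi 0) := (integrableOn_c hα h₁).const_mul a
  have i₂ : IntegrableOn (fun t => b * g σ₂ t) (Ioi 0) := (integrableOn_c hα h₂).const_mul b
  have i₃ : IntegrableOn (g (a * σ₁ + b * σ₂)) (Ioi 0) := integrableOn_c hα h₃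
  have i₁₂ : IntegrableOn (fun t => a * g σ₁ t + b * g σ₂ t) (Ioi 0) := i₁.add i₂
  have hpos : 0 < ∫ t in Ioi (0 : ℝ), (a * g σ₁ t + b * g σ₂ t - g (a * σ₁ + b * σ₂) t) := by
    -- Strictness comes from the base `1 + t ≠ 1`; the base `|1 - t|` equals `1` at `t = 2` and
    -- gives only weak convexity. The point `t = 1` is dropped because there the base is `0` and the
    -- power is not an exponential.
    have key : ∀ t ∈ Ioi (0 : ℝ), t ≠ 1 →
        0 < a * g σ₁ t + b * g σ₂ t - g (a * σ₁ + b * σ₂) t := by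
      intro t ht ht1
      have ht0 : (0 : ℝ) < t := ht
      have e1 := rpow_convexComb_le (σ₁ := σ₁) (σ₂ := σ₂) (x := |1 - t|)
        (abs_pos.2 (sub_ne_zero.2 ht1.symm)) ha hb hab
      have e2 := rpow_convexComb_lt (x := 1 + t) (by linarith) (by linarith) hσ ha hb hab
      simp only [hg]
      rw [mul_div_assoc', mul_div_assoc', ← add_div, ← sub_div]
      refine div_pos ?_ (Real.rpow_pos_of_pos ht0 _)
      have : a * 2 + b * 2 = 2 := by linarith
      linarith
    have hae : ∀ᵐ t ∂(volume.restrict (Ioi (0 : ℝ))), t ∈ Ioi (0 : ℝ) ∧ t ≠ 1 := by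
      filter_upwards [ae_restrict_mem measurableSet_Ioi,
        ae_restrict_of_ae (Measure.ae_ne volume (1 : ℝ))] with t h1 h2 using ⟨h1, h2⟩
    refine (integral_pos_iff_support_of_nonneg_ae ?_ (i₁₂.sub i₃)).2 ?_
    · filter_upwards [hae] with t ht using (key t ht.1 ht.2).le
    · refine lt_of_lt_of_le ?_ (measure_mono (s := Ioo (0 : ℝ) 1)
        fun t ht => (key t ht.1 ht.2.ne).ne')
      rw [Measure.restrict_apply measurableSet_Ioo, inter_eq_left.2 Ioo_subset_Ioi_self]
      simp
  rw [integral_sub i₁₂ i₃, integral_add i₁ i₂, integral_const_mul, integral_const_mul] at hpos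
  simp only [c]
  linarith

theorem hasDerivAt_affine_div_rpow {p q t : ℝ} (α : ℝ) (ht : 0 < t) (hpq : 0 < p + q * t) :
    HasDerivAt (fun t => ((p + q * t) / t) ^ (2 * α))
      (-(2 * α) * p * (p + q * t) ^ (2 * α - 1) / t ^ (1 + 2 * α)) t := by
  have h1 : HasDerivAt (fun t => (p + q * t) / t) ((q * t - (p + q * t) * 1) / t ^ 2) t := by
    have := (((hasDerivAt_id' t).const_mul q).const_add p).div (hasDerivAt_id' t) ht.ne'
    rwa [mul_one] at this
  convert! h1.rpow_const (p := 2 * α) (Or.inl (div_pos hpq ht).ne') using 1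
  have e : t ^ (1 + 2 * α) = t ^ (2 * α - 1) * t ^ 2 := by
    rw [← Real.rpow_natCast t 2, ← Real.rpow_add ht]
    congr 1
    push_cast
    ring
  rw [Real.div_rpow hpq.le ht.le, e]
  have := (Real.rpow_pos_of_pos ht (2 * α - 1)).ne'
  field_simp
  ring

/-- For the exponent `2α - 1`, each term of the integrand is a multiple of the derivative of some
`((p + q t)/t)^(2α)`. Splitting at `t = 1`, the boundary terms at `0` and at infinity vanish, and
those at `1` cancel between the two pieces. -/
theorem c_two_mul_sub_one {α : ℝ} (hα : α ∈ Ioo (0 : ℝ) 1) : c α (2 * α - 1) = 0 := by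
  have hα0 := hα.1
  have hα1 := hα.2
  have hint := integrableOn_c hα (σ := 2 * α - 1) ⟨by linarith, by linarith⟩
  set f : ℝ → ℝ := fun t =>
    (|1 - t| ^ (2 * α - 1) + (1 + t) ^ (2 * α - 1) - 2) / t ^ (1 + 2 * α) with hf
  set P : ℝ → ℝ → ℝ → ℝ := fun p q t => ((p + q * t) / t) ^ (2 * α) with hP
  have hPc : ∀ p q, 0 ≤ p + q → ContinuousAt (P p q) 1 := by
    intro p q hpq
    refine ContinuousAt.rpow_const ?_ (Or.inr (by linarith))
    exact ContinuousAt.div (by fun_prop) continuousAt_id one_ne_zero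
  have hP1 : P 1 (-1) 1 = 0 := by simp [hP, Real.zero_rpow (by positivity : 2 * α ≠ 0)]
  have hP1' : P (-1) 1 1 = 0 := by simp [hP, Real.zero_rpow (by positivity : 2 * α ≠ 0)]
  set m := P 1 0 1 with hm
  set m' := P 1 1 1 with hm'
  have I1 : ∫ t in (0 : ℝ)..1, f t = -(1 / (2 * α)) * (0 + m' - 2 * m) - 0 := by
    refine intervalIntegral.integral_eq_sub_of_hasDerivAt_of_tendsto (a := 0) (b := 1) one_pos
      (f := fun t => -(1 / (2 * α)) * (P 1 (-1) t + P 1 1 t - 2 * P 1 0 t)) ?_ ?_ ?_ ?_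
    · intro t ht
      have d1 := hasDerivAt_affine_div_rpow (p := 1) (q := -1) α ht.1 (by linarith [ht.2])
      have d2 := hasDerivAt_affine_div_rpow (p := 1) (q := 1) α ht.1 (by linarith [ht.1])
      have d3 := hasDerivAt_affine_div_rpow (p := 1) (q := 0) α ht.1 (by linarith)
      convert! ((d1.add d2).sub (d3.const_mul 2)).const_mul (-(1 / (2 * α))) using 1
      have : |1 - t| = 1 + -1 * t := by rw [abs_of_pos (by linarith [ht.2])]; ring
      simp only [hf, this, one_mul, mul_one, zero_mul, add_zero, Real.one_rpow]
      field_simp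
      ring
    · rw [intervalIntegrable_iff_integrableOn_Ioc_of_le zero_le_one]
      exact hint.mono_set Ioc_subset_Ioi_self
    -- At `0` the three terms combine to a second difference of `s ^ (2α)` at `1`, divided by `t ^
    -- (2α)`, hence `O(t^(2-2α))`, although each term blows up.
    · obtain ⟨K, hK, r, hr, hKr⟩ := exists_second_difference_bound
        (f := fun s : ℝ => s ^ (2 * α)) (x := 1) (Real.contDiffAt_rpow_const_of_ne one_ne_zero)
      have hlim : Tendsto (fun t : ℝ => 1 / (2 * α) * (K * t ^ (2 - 2 * α))) (𝓝[>] 0) (𝓝 0) := by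
        have : ContinuousAt (fun t : ℝ => 1 / (2 * α) * (K * t ^ (2 - 2 * α))) 0 := by
          refine continuousAt_const.mul (continuousAt_const.mul ?_)
          exact ContinuousAt.rpow_const continuousAt_id (Or.inr (by linarith))
        have h0 := this.tendsto
        simp only [Real.zero_rpow (by linarith : 2 - 2 * α ≠ 0), mul_zero] at h0
        exact h0.mono_left nhdsWithin_le_nhds
      refine squeeze_zero_norm' ?_ hlim
      filter_upwards [Ioo_mem_nhdsGT (lt_min hr one_pos)] with t ht
      have ht0 := ht.1
      have ht1 := ht.2.trans_le (min_le_right _ _)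
      have h := hKr t (by
        rw [Real.norm_eq_abs, abs_of_pos ht0]
        exact ht.2.trans_le (min_le_left _ _))
      have e : P 1 (-1) t + P 1 1 t - 2 * P 1 0 t =
          ((1 + t) ^ (2 * α) + (1 - t) ^ (2 * α) - 2 * 1 ^ (2 * α)) / t ^ (2 * α) := by
        change ((1 + -1 * t) / t) ^ (2 * α) + ((1 + 1 * t) / t) ^ (2 * α)
          - 2 * ((1 + 0 * t) / t) ^ (2 * α) = _
        rw [Real.div_rpow (by linarith) ht0.le, Real.div_rpow (by linarith) ht0.le,
          Real.div_rpow (by linarith) ht0.le]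
        ring_nf
      rw [e, norm_mul, norm_neg, Real.norm_of_nonneg (by positivity : 0 ≤ 1 / (2 * α)),
        Real.norm_eq_abs, abs_div, abs_of_pos (Real.rpow_pos_of_pos ht0 _)]
      gcongr
      rw [div_le_iff₀ (Real.rpow_pos_of_pos ht0 _), mul_assoc, ← Real.rpow_add ht0]
      have : (2 - 2 * α + 2 * α) = (2 : ℕ) := by push_cast; ring
      rw [this, Real.rpow_natCast]
      simpa using h
    · have h := (((hPc 1 (-1) (by norm_num)).add (hPc 1 1 (by norm_num))).sub
        ((hPc 1 0 (by norm_num)).const_mul 2)).const_mul (-(1 / (2 * α)))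
      have h0 : Tendsto (fun t => -(1 / (2 * α)) * (P 1 (-1) t + P 1 1 t - 2 * P 1 0 t)) (𝓝[<] 1)
          (𝓝 (-(1 / (2 * α)) * (P 1 (-1) 1 + P 1 1 1 - 2 * P 1 0 1))) :=
        h.tendsto.mono_left nhdsWithin_le_nhds
      rwa [hP1] at h0
  have I2 : ∫ t in Ioi (1 : ℝ), f t = 0 - 1 / (2 * α) * (0 - m' + 2 * m) := by
    have := integral_Ioi_of_hasDerivAt_of_tendsto (a := 1) (m := 0) (f' := f)
      (f := fun t => 1 / (2 * α) * (P (-1) 1 t - P 1 1 t + 2 * P 1 0 t)) ?_ ?_ ?_ ?_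
    · rw [this, hP1']
    · exact ((((hPc (-1) 1 (by norm_num)).sub (hPc 1 1 (by norm_num))).add
        ((hPc 1 0 (by norm_num)).const_mul 2)).const_mul (1 / (2 * α))).continuousWithinAt
    · intro t ht
      have ht1 : (1 : ℝ) < t := ht
      have d1 := hasDerivAt_affine_div_rpow (p := -1) (q := 1) (t := t) α (by linarith)
        (by linarith)
      have d2 := hasDerivAt_affine_div_rpow (p := 1) (q := 1) (t := t) α (by linarith)
        (by linarith)
      have d3 := hasDerivAt_affine_div_rpow (p := 1) (q := 0) (t := t) α (by linarith)
        (by linarith)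
      convert! ((d1.sub d2).add (d3.const_mul 2)).const_mul (1 / (2 * α)) using 1
      have : |1 - t| = -1 + 1 * t := by rw [abs_of_neg (by linarith)]; ring
      simp only [hf, this, one_mul, mul_one, zero_mul, add_zero, Real.one_rpow]
      field_simp
      ring
    · exact hint.mono_set (Ioi_subset_Ioi zero_le_one)
    · have hq : ∀ p q : ℝ, 0 ≤ q → Tendsto (P p q) atTop (𝓝 (q ^ (2 * α))) := by
        intro p q hq
        refine Tendsto.rpow_const ?_ (Or.inr (by linarith))
        have h1 : Tendsto (fun t : ℝ => p / t + q) atTop (𝓝 (0 + q)) :=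
          (tendsto_const_nhds.div_atTop tendsto_id).add_const q
        rw [zero_add] at h1
        refine h1.congr' ?_
        filter_upwards [eventually_gt_atTop 0] with t ht
        field_simp
      have h0 := (((hq (-1) 1 zero_le_one).sub (hq 1 1 zero_le_one)).add
        ((hq 1 0 le_rfl).const_mul 2)).const_mul (1 / (2 * α))
      simpa [Real.zero_rpow (by positivity : 2 * α ≠ 0)] using h0
  have hsplit : ∫ t in Ioi (0 : ℝ), f t = (∫ t in (0 : ℝ)..1, f t) + ∫ t in Ioi (1 : ℝ), f t := by
    rw [intervalIntegral.integral_of_le zero_le_one, ← setIntegral_union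
      (Ioc_disjoint_Ioi le_rfl) measurableSet_Ioi (hint.mono_set Ioc_subset_Ioi_self)
      (hint.mono_set (Ioi_subset_Ioi zero_le_one)), Ioc_union_Ioi_eq_Ioi zero_le_one]
  change ∫ t in Ioi (0 : ℝ), f t = 0
  rw [hsplit, I1, I2]
  ring

/-- Here `τ < 0 < 2α - 1`: a strictly convex function is positive to the left of its two zeros. -/
theorem c_pos_of_half_lt {α τ : ℝ} (hα : α ∈ Ioo (1 / 2 : ℝ) 1) (hτ : τ ∈ Ioo (-1 : ℝ) 0) :
    0 < c α τ := by
  obtain ⟨hα0, hα1⟩ := hα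
  have hα' : α ∈ Ioo (0 : ℝ) 1 := ⟨by linarith, hα1⟩
  have h := (strictConvexOn_c hα').slope_strict_mono_adjacent (x := τ) (y := 0) (z := 2 * α - 1)
    ⟨hτ.1, by linarith [hτ.2]⟩ ⟨by linarith, by linarith⟩ hτ.2 (by linarith)
  rw [c_two_mul_sub_one hα', c_zero_right, sub_self, zero_div, div_lt_iff₀ (by linarith [hτ.2])]
    at h
  linarith

theorem c_half_nonneg {τ : ℝ} (hτ : τ ∈ Ioo (-1 : ℝ) 0) : 0 ≤ c (1 / 2) τ := by
  set F : ℝ → ℝ := fun t => |1 - t| ^ τ + (1 + t) ^ τ - 2 with hF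
  have i1 := integrableOn_c (α := 1 / 2) (σ := τ) ⟨by norm_num, by norm_num⟩
    ⟨hτ.1, by linarith [hτ.2]⟩
  have i2 := integrableOn_c (α := 3 / 4) (σ := τ) ⟨by norm_num, by norm_num⟩
    ⟨hτ.1, by linarith [hτ.2]⟩
  have hlim : Tendsto (fun α => c α τ) (𝓝[>] (1 / 2)) (𝓝 (c (1 / 2) τ)) := by
    -- For `α` between `1/2` and `3/4` the weight `t ^ (-1-2α)` lies below its value at `3/4` when
    -- `t ≤ 1` and below its value at `1/2` when `t ≥ 1`, so the sum of the two endpoint integrands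
    -- dominates.
    refine tendsto_integral_filter_of_dominated_convergence
      (fun t => ‖F t / t ^ (1 + 2 * (1 / 2 : ℝ))‖ + ‖F t / t ^ (1 + 2 * (3 / 4 : ℝ))‖)
      (Eventually.of_forall fun α => Measurable.aestronglyMeasurable (by fun_prop)) ?_
      (i1.norm.add i2.norm) ?_
    · filter_upwards [Ioo_mem_nhdsGT (by norm_num : (1 / 2 : ℝ) < 3 / 4)] with α hα
      filter_upwards [ae_restrict_mem measurableSet_Ioi] with t ht
      have ht0 : (0 : ℝ) < t := ht
      simp only [norm_div, Real.norm_of_nonneg (Real.rpow_nonneg ht0.le _)]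
      rcases le_total t 1 with h | h
      · have : t ^ (1 + 2 * (3 / 4 : ℝ)) ≤ t ^ (1 + 2 * α) :=
          Real.rpow_le_rpow_of_exponent_ge ht0 h (by linarith [hα.2])
        refine le_add_of_nonneg_of_le (by positivity) ?_
        gcongr
      · have : t ^ (1 + 2 * (1 / 2 : ℝ)) ≤ t ^ (1 + 2 * α) :=
          Real.rpow_le_rpow_of_exponent_le h (by linarith [hα.1])
        refine le_add_of_le_of_nonneg ?_ (by positivity)
        gcongr
    · filter_upwards [ae_restrict_mem measurableSet_Ioi] with t ht
      have ht0 : (0 : ℝ) < t := ht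
      have : ContinuousAt (fun α : ℝ => F t / t ^ (1 + 2 * α)) (1 / 2) := by
        refine continuousAt_const.div ?_ (Real.rpow_pos_of_pos ht0 _).ne'
        exact (Real.continuousAt_const_rpow ht0.ne').comp (by fun_prop)
      exact this.tendsto.mono_left nhdsWithin_le_nhds
  refine ge_of_tendsto hlim ?_
  filter_upwards [Ioo_mem_nhdsGT (by norm_num : (1 / 2 : ℝ) < 1)] with α hα
  exact (c_pos_of_half_lt hα hτ).le

/-- Strict convexity at `τ < τ/2 < 0` and `c (1/2) 0 = 0` give `c(τ) > 2 c(τ/2)`, and the right side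
is nonnegative. -/
theorem c_half_pos {τ : ℝ} (hτ : τ ∈ Ioo (-1 : ℝ) 0) : 0 < c (1 / 2) τ := by
  have h := (strictConvexOn_c (α := 1 / 2) ⟨by norm_num, by norm_num⟩).slope_strict_mono_adjacent
    (x := τ) (y := τ / 2) (z := 0) ⟨hτ.1, by linarith [hτ.2]⟩ ⟨by norm_num, by norm_num⟩
    (by linarith [hτ.2]) (by linarith [hτ.2])
  have h2 := c_half_nonneg (τ := τ / 2) ⟨by linarith [hτ.1], by linarith [hτ.2]⟩
  rw [c_zero_right, div_lt_div_iff₀ (by linarith [hτ.2]) (by linarith [hτ.2])] at h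
  nlinarith [hτ.2]

theorem isThreshold : IsThreshold (1 / 2) fun α => 2 * α - 1 where
  alpha_mem := ⟨by norm_num, by norm_num⟩
  pos_of_ge := by
    intro α hα τ hτ
    rcases hα.1.eq_or_lt with h | h
    · rw [← h]
      exact c_half_pos hτ
    · exact c_pos_of_half_lt ⟨h, hα.2⟩ hτ
  tau_mem := fun α hα => ⟨by linarith [hα.1], by linarith [hα.2]⟩
  pos_of_lt := by
    intro α hα τ hτ
    have hα' : α ∈ Ioo (0 : ℝ) 1 := ⟨hα.1, by linarith [hα.2]⟩
    have h := (strictConvexOn_c hα').slope_strict_mono_adjacent (x := τ) (y := 2 * α - 1) (z := 0)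
      ⟨hτ.1, by linarith [hτ.2]⟩ ⟨by linarith, by linarith [hα.1]⟩ hτ.2 (by linarith [hα.2])
    rw [c_two_mul_sub_one hα', c_zero_right, sub_self, zero_div, div_lt_iff₀ (by linarith [hτ.2])]
      at h
    linarith
  zero := fun α hα => c_two_mul_sub_one ⟨hα.1, by linarith [hα.2]⟩
  neg_of_gt := by
    intro α hα τ hτ
    have hα' : α ∈ Ioo (0 : ℝ) 1 := ⟨hα.1, by linarith [hα.2]⟩
    have h := (strictConvexOn_c hα').slope_strict_mono_adjacent (x := 2 * α - 1) (y := τ) (z := 0)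
      ⟨by linarith [hα.1], by linarith⟩ ⟨by linarith, by linarith [hα.1]⟩ hτ.1 hτ.2
    rw [c_two_mul_sub_one hα', c_zero_right, div_lt_div_iff₀ (by linarith [hτ.1])
      (by linarith [hτ.2])] at h
    have h1 := hτ.1
    have h2 := hτ.2
    nlinarith [hα.2]

/-! ### The distance to a `C²` hypersurface -/

section Geometry

variable {F : Type*} [NormedAddCommGroup F] [InnerProductSpace ℝ F]

/-- In the ball of radius `R` about `p`, the set `S` is a graph over the hyperplane through `p` with
unit normal `n`; the graph is `1/2`-Lipschitz (measured along chords) and tangent to the hyperplane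
to second order, with constant `K`. -/
structure IsGraphAt (S : Set F) (K R : ℝ) (p n : F) : Prop where
  norm_eq_one : ‖n‖ = 1
  exists_height : ∀ w, inner ℝ n w = 0 → ‖w‖ < R → ∃ h : ℝ, |h| ≤ K * ‖w‖ ^ 2 ∧ p + w + h • n ∈ S
  lipschitz : ∀ q₁ ∈ S, ∀ q₂ ∈ S, ‖q₁ - p‖ < R → ‖q₂ - p‖ < R →
    |inner ℝ n (q₁ - q₂)| ≤ 1 / 2 * ‖q₁ - q₂‖
  tangent : ∀ q ∈ S, ‖q - p‖ < R → |inner ℝ n (q - p)| ≤ K * ‖q - p‖ ^ 2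

theorem IsGraphAt.mono {S : Set F} {K K' R R' : ℝ} {p n : F} (h : IsGraphAt S K R p n)
    (hK : K ≤ K') (hR : R' ≤ R) : IsGraphAt S K' R' p n where
  norm_eq_one := h.norm_eq_one
  exists_height := fun w hw hwR => by
    obtain ⟨t, ht, hS⟩ := h.exists_height w hw (hwR.trans_le hR)
    exact ⟨t, ht.trans (by gcongr), hS⟩
  lipschitz := fun q₁ h₁ q₂ h₂ h₁' h₂' =>
    h.lipschitz q₁ h₁ q₂ h₂ (h₁'.trans_le hR) (h₂'.trans_le hR)
  tangent := fun q hq hqR => (h.tangent q hq (hqR.trans_le hR)).trans (by gcongr)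

theorem IsGraphAt.neg {S : Set F} {K R : ℝ} {p n : F} (h : IsGraphAt S K R p n) :
    IsGraphAt S K R p (-n) where
  norm_eq_one := by rw [norm_neg, h.norm_eq_one]
  exists_height := fun w hw hwR => by
    obtain ⟨t, ht, hS⟩ := h.exists_height w (by simpa using hw) hwR
    exact ⟨-t, by rwa [abs_neg], by simpa using hS⟩
  lipschitz := fun q₁ h₁ q₂ h₂ h₁' h₂' => by
    rw [inner_neg_left, abs_neg]
    exact h.lipschitz q₁ h₁ q₂ h₂ h₁' h₂'
  tangent := fun q hq hqR => by
    rw [inner_neg_left, abs_neg]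
    exact h.tangent q hq hqR

theorem norm_add_smul_sq {n w : F} (hn : ‖n‖ = 1) (hw : inner ℝ n w = 0) (h : ℝ) :
    ‖w + h • n‖ ^ 2 = ‖w‖ ^ 2 + h ^ 2 := by
  rw [norm_add_sq_real, inner_smul_right, real_inner_comm, hw, norm_smul, hn]
  simp

/-- The normal at `p` is the normalised gradient of `φ`. Points of `S` over the tangent plane come
from the intermediate value theorem along the normal, and the chord bounds from Taylor's formula
between two zeros of `φ`. All constants are uniform for `p` near `p₀`. -/
theorem exists_isGraphAt_of_level_set [CompleteSpace F] {S U : Set F} {φ : F → ℝ} {p₀ : F}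
    (hU : IsOpen U) (hp₀ : p₀ ∈ U) (hφ : ContDiffOn ℝ 2 φ U) (hd : fderiv ℝ φ p₀ ≠ 0)
    (hS : S ∩ U = {y ∈ U | φ y = 0}) :
    ∃ K > 0, ∃ R > 0, ∀ p ∈ S, ‖p - p₀‖ < R → ∃ n, IsGraphAt S K R p n := by
  obtain ⟨K₀, hK₀, r₁, hr₁, hcont, hlip, htay⟩ :=
    exists_taylor_bound (hφ.contDiffAt (hU.mem_nhds hp₀))
  obtain ⟨r₂, hr₂, hU₂⟩ := Metric.isOpen_iff.1 hU p₀ hp₀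
  set m := ‖fderiv ℝ φ p₀‖ with hm
  have hm0 : 0 < m := norm_pos_iff.2 hd
  -- The factors `4` keep every point used inside the neighbourhoods of validity. The bound `12 K₀ R
  -- ≤ m` keeps the gradient above `m / 2`, makes the height `H` at most `‖w‖`, and limits the slope
  -- along chords to `1/2`.
  set R := min (min (r₁ / 4) (r₂ / 4)) (m / (12 * K₀)) with hR
  have hR0 : 0 < R := by positivity
  have hR1 : 4 * R ≤ r₁ := by
    have : R ≤ r₁ / 4 := (min_le_left _ _).trans (min_le_left _ _)
    linarith
  have hR2 : 4 * R ≤ r₂ := by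
    have : R ≤ r₂ / 4 := (min_le_left _ _).trans (min_le_right _ _)
    linarith
  have hR3 : 12 * (K₀ * R) ≤ m := by
    have : R ≤ m / (12 * K₀) := min_le_right _ _
    rw [le_div_iff₀ (by positivity)] at this
    linarith
  have hball : ∀ y, ‖y - p₀‖ < 4 * R → y ∈ Metric.ball p₀ r₁ ∧ y ∈ U := fun y hy =>
    ⟨by rw [mem_ball_iff_norm]; linarith, hU₂ (by rw [mem_ball_iff_norm]; linarith)⟩
  have hzero : ∀ y ∈ S, y ∈ U → φ y = 0 := fun y h1 h2 => by
    have : y ∈ {y ∈ U | φ y = 0} := hS ▸ ⟨h1, h2⟩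
    exact this.2
  have hmem : ∀ y ∈ U, φ y = 0 → y ∈ S := fun y h1 h2 => by
    have : y ∈ S ∩ U := hS ▸ ⟨h1, h2⟩
    exact this.1
  refine ⟨4 * K₀ / m, by positivity, R, hR0, fun p hpS hp => ?_⟩
  have hpb := hball p (by linarith)
  have hnear : ∀ q, ‖q - p‖ < 3 * R → ‖q - p₀‖ < 4 * R := fun q hq => by
    have := norm_add_le (q - p) (p - p₀)
    rw [sub_add_sub_cancel] at this
    linarith
  set M := ‖fderiv ℝ φ p‖ with hM
  have hMm : m / 2 ≤ M := by
    have h1 := hlip p₀ (by simpa using hr₁) p hpb.1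
    have h2 : K₀ * ‖p - p₀‖ ≤ K₀ * R := by gcongr
    have h3 := norm_sub_norm_le (fderiv ℝ φ p₀) (fderiv ℝ φ p)
    rw [norm_sub_rev] at h3
    linarith
  have hM0 : 0 < M := by linarith
  set g := (InnerProductSpace.toDual ℝ F).symm (fderiv ℝ φ p) with hg
  have hgM : ‖g‖ = M := LinearIsometryEquiv.norm_map _ _
  have hfd : ∀ v, fderiv ℝ φ p v = M * inner ℝ (M⁻¹ • g) v := fun v => by
    rw [inner_smul_left, hg, InnerProductSpace.toDual_symm_apply]
    simp only [conj_trivial]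
    field_simp
  set n := M⁻¹ • g with hn
  have hn1 : ‖n‖ = 1 := by
    rw [hn, norm_smul, hgM, norm_inv, Real.norm_of_nonneg hM0.le, inv_mul_cancel₀ hM0.ne']
  have hφp : φ p = 0 := hzero p hpS hpb.2
  refine ⟨n, hn1, ?_, ?_, ?_⟩
  · intro w hw hwR
    set H := 4 * K₀ / m * ‖w‖ ^ 2 with hH
    have hH0 : 0 ≤ H := by positivity
    have hHw : H ≤ ‖w‖ := by
      rw [hH, div_mul_eq_mul_div, div_le_iff₀ hm0]
      have h1 : K₀ * ‖w‖ ≤ K₀ * R := by gcongr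
      nlinarith [norm_nonneg w]
    have hin : ∀ h ∈ Icc (-H) H, p + w + h • n - p = w + h • n ∧
        ‖p + w + h • n - p‖ < 3 * R := by
      intro h hh
      have e : p + w + h • n - p = w + h • n := by abel
      refine ⟨e, ?_⟩
      rw [e]
      refine (norm_add_le _ _).trans_lt ?_
      rw [norm_smul, hn1, mul_one, Real.norm_eq_abs]
      have := abs_le.2 hh
      linarith
    have hval : ∀ h ∈ Icc (-H) H, |φ (p + w + h • n) - M * h| ≤ K₀ * (‖w‖ ^ 2 + h ^ 2) := by
      intro h hh
      obtain ⟨e, h1⟩ := hin h hh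
      have h2 := htay p hpb.1 (p + w + h • n) (hball _ (hnear _ h1)).1
      rwa [e, hfd, hφp, sub_zero, norm_add_smul_sq hn1 hw, inner_add_right, hw, inner_smul_right,
        real_inner_self_eq_norm_sq, hn1, one_pow, mul_one, zero_add] at h2
    -- The first-order term at height `±H` beats the Taylor remainder, so `φ` changes sign on the
    -- segment.
    have hMH : K₀ * (‖w‖ ^ 2 + H ^ 2) ≤ M * H := by
      have h1 : H ^ 2 ≤ ‖w‖ ^ 2 := by gcongr
      have h2 : m / 2 * H ≤ M * H := by gcongr
      have h3 : m / 2 * H = 2 * (K₀ * ‖w‖ ^ 2) := by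
        rw [hH]
        field_simp
        ring
      nlinarith
    have hc : ContinuousOn (fun h : ℝ => φ (p + w + h • n)) (Icc (-H) H) := by
      refine hcont.comp (by fun_prop) fun h hh => ?_
      exact (hball _ (hnear _ (hin h hh).2)).1
    have h1 := abs_le.1 (hval H ⟨by linarith, le_rfl⟩)
    have h2 := abs_le.1 (hval (-H) ⟨le_rfl, by linarith⟩)
    rw [neg_sq] at h2
    obtain ⟨h, hh, hz⟩ := intermediate_value_Icc (by linarith : -H ≤ H) hc
      (show (0 : ℝ) ∈ Icc _ _ from ⟨by linarith, by linarith⟩)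
    exact ⟨h, abs_le.2 hh, hmem _ (hball _ (hnear _ (hin h hh).2)).2 hz⟩
  · intro q₁ h₁ q₂ h₂ hq₁ hq₂
    have b₁ := hball _ (hnear q₁ (by linarith))
    have b₂ := hball _ (hnear q₂ (by linarith))
    have t1 := htay q₂ b₂.1 q₁ b₁.1
    rw [hzero _ h₁ b₁.2, hzero _ h₂ b₂.2, sub_zero, zero_sub, abs_neg] at t1
    have t2 : |fderiv ℝ φ q₂ (q₁ - q₂) - fderiv ℝ φ p (q₁ - q₂)| ≤
        K₀ * ‖q₂ - p‖ * ‖q₁ - q₂‖ := by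
      have := (fderiv ℝ φ q₂ - fderiv ℝ φ p).le_opNorm (q₁ - q₂)
      rw [_root_.sub_apply, Real.norm_eq_abs] at this
      refine this.trans ?_
      gcongr
      exact hlip p hpb.1 q₂ b₂.1
    have t3 : |fderiv ℝ φ p (q₁ - q₂)| ≤ K₀ * (‖q₁ - q₂‖ + ‖q₂ - p‖) * ‖q₁ - q₂‖ := by
      have := abs_sub_abs_le_abs_sub (fderiv ℝ φ p (q₁ - q₂)) (fderiv ℝ φ q₂ (q₁ - q₂))
      rw [abs_sub_comm] at this
      nlinarith
    have t4 : ‖q₁ - q₂‖ ≤ 2 * R := by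
      have := norm_sub_le (q₁ - p) (q₂ - p)
      rw [sub_sub_sub_cancel_right] at this
      linarith
    have t5 : K₀ * (‖q₁ - q₂‖ + ‖q₂ - p‖) * ‖q₁ - q₂‖ ≤ K₀ * (2 * R + R) * ‖q₁ - q₂‖ := by
      gcongr
    rw [hfd, abs_mul, abs_of_pos hM0] at t3
    have t6 : m / 2 * |inner ℝ n (q₁ - q₂)| ≤ M * |inner ℝ n (q₁ - q₂)| := by gcongr
    have t7 : K₀ * (2 * R + R) * ‖q₁ - q₂‖ ≤ m / 4 * ‖q₁ - q₂‖ := by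
      gcongr
      linarith
    have t8 : m * |inner ℝ n (q₁ - q₂)| ≤ m * (1 / 2 * ‖q₁ - q₂‖) := by linarith
    exact le_of_mul_le_mul_left t8 hm0
  · intro q hq hqR
    have b := hball _ (hnear q (by linarith))
    have t1 := htay p hpb.1 q b.1
    rw [hzero _ hq b.2, hφp, sub_zero, zero_sub, abs_neg, hfd, abs_mul, abs_of_pos hM0] at t1
    rw [div_mul_eq_mul_div, le_div_iff₀ hm0]
    have t6 : m / 2 * |inner ℝ n (q - p)| ≤ M * |inner ℝ n (q - p)| := by gcongr
    nlinarith [sq_nonneg ‖q - p‖, mul_nonneg hK₀.le (sq_nonneg ‖q - p‖)]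

theorem exists_isGraphAt_of_isCompact {S : Set F} (hS : IsCompact S)
    (h : ∀ p₀ ∈ S, ∃ K > 0, ∃ R > 0, ∀ p ∈ S, ‖p - p₀‖ < R → ∃ n, IsGraphAt S K R p n) :
    ∃ K > 0, ∃ R > 0, ∀ p ∈ S, ∃ n, IsGraphAt S K R p n := by
  have := hS.induction_on (p := fun s => ∃ K > 0, ∃ R > 0, ∀ p ∈ S, p ∈ s →
    ∃ n, IsGraphAt S K R p n) ⟨1, one_pos, 1, one_pos, by simp⟩ ?_ ?_ ?_
  · obtain ⟨K, hK, R, hR, hp⟩ := this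
    exact ⟨K, hK, R, hR, fun p h => hp p h h⟩
  · rintro s t hst ⟨K, hK, R, hR, hp⟩
    exact ⟨K, hK, R, hR, fun p h1 h2 => hp p h1 (hst h2)⟩
  · rintro s t ⟨K, hK, R, hR, hp⟩ ⟨K', hK', R', hR', hp'⟩
    refine ⟨max K K', by positivity, min R R', by positivity, ?_⟩
    rintro p h1 (h2 | h2)
    · obtain ⟨n, hn⟩ := hp p h1 h2
      exact ⟨n, hn.mono (le_max_left _ _) (min_le_left _ _)⟩
    · obtain ⟨n, hn⟩ := hp' p h1 h2
      exact ⟨n, hn.mono (le_max_right _ _) (min_le_right _ _)⟩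
  · intro p₀ hp₀
    obtain ⟨K, hK, R, hR, hp⟩ := h p₀ hp₀
    refine ⟨Metric.ball p₀ R, mem_nhdsWithin_of_mem_nhds (Metric.ball_mem_nhds p₀ hR),
      K, hK, R, hR, fun p h1 h2 => hp p h1 ?_⟩
    rwa [mem_ball_iff_norm] at h2

/-- Here `s₀` is the height of the graph over `w`. The linear lower bound uses only that chords have
slope at most `1/2`; the quadratic comparison with `|s|` uses tangency at `p` and the position of
the nearest point. -/
theorem IsGraphAt.infDist_bounds {S : Set F} (hS : IsCompact S) {K R : ℝ} {p n : F}
    (hK : 1 ≤ K) (h : IsGraphAt S K R p n) (hp : p ∈ S) {r : ℝ} (hr : 8 * r ≤ R)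
    (hrK : 8 * K * r ≤ 1) {w : F} (hw : inner ℝ n w = 0) (hwr : ‖w‖ < r) :
    ∃ s₀ : ℝ, |s₀| ≤ K * ‖w‖ ^ 2 ∧ ∀ s : ℝ, |s| < r →
      |Metric.infDist (p + w + s • n) S - abs s| ≤ 8 * K * ‖w‖ ^ 2 ∧
      |s - s₀| / 3 ≤ Metric.infDist (p + w + s • n) S := by
  have hr0 : 0 < r := (norm_nonneg w).trans_lt hwr
  obtain ⟨s₀, hs₀, hq₀⟩ := h.exists_height w hw (by linarith)
  refine ⟨s₀, hs₀, fun s hs => ?_⟩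
  obtain ⟨q, hq, hdist⟩ := hS.exists_infDist_eq_dist ⟨p, hp⟩ (p + w + s • n)
  have hn := h.norm_eq_one
  set z := p + w + s • n with hz
  have hzp : ‖z - p‖ < 2 * r := by
    have e : z - p = w + s • n := by rw [hz]; abel
    rw [e]
    refine (norm_add_le _ _).trans_lt ?_
    rw [norm_smul, hn, mul_one, Real.norm_eq_abs]
    linarith
  have hDp : Metric.infDist z S ≤ ‖z - p‖ := by
    rw [← dist_eq_norm]
    exact Metric.infDist_le_dist_of_mem hp
  rw [dist_eq_norm] at hdist
  have hqp : ‖q - p‖ < 4 * r := by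
    have := norm_sub_le (z - p) (z - q)
    rw [sub_sub_sub_cancel_left] at this
    linarith
  have hw2 : K * ‖w‖ ^ 2 ≤ r := by
    have h1 : K * ‖w‖ ≤ K * r := by gcongr
    nlinarith [norm_nonneg w]
  -- With `q` nearest to `z` and `D = ‖z - q‖`, the slope bound gives `|s - s₀| ≤ D + (|s - s₀| +
  -- D)/2`, that is, `|s - s₀| ≤ 3 D`.
  have hlow : |s - s₀| / 3 ≤ Metric.infDist z S := by
    have h1 : ‖p + w + s₀ • n - p‖ < R := by
      have e : p + w + s₀ • n - p = w + s₀ • n := by abel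
      rw [e]
      refine (norm_add_le _ _).trans_lt ?_
      rw [norm_smul, hn, mul_one, Real.norm_eq_abs]
      linarith
    have h2 := h.lipschitz _ hq₀ q hq h1 (by linarith)
    have e1 : z - (p + w + s₀ • n) = (s - s₀) • n := by rw [hz, sub_smul]; abel
    have h3 : |inner ℝ n (z - q)| ≤ ‖z - q‖ := by
      have := abs_real_inner_le_norm n (z - q)
      rwa [hn, one_mul] at this
    have h4 : inner ℝ n (z - q) = s - s₀ + inner ℝ n (p + w + s₀ • n - q) := by
      have e2 : z - q = (s - s₀) • n + (p + w + s₀ • n - q) := by rw [← e1]; abel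
      rw [e2, inner_add_right, inner_smul_right, real_inner_self_eq_norm_sq, hn]
      ring
    have h5 : ‖p + w + s₀ • n - q‖ ≤ |s - s₀| + ‖z - q‖ := by
      have e3 : p + w + s₀ • n - q = -((s - s₀) • n) + (z - q) := by rw [← e1]; abel
      rw [e3]
      refine (norm_add_le _ _).trans (le_of_eq ?_)
      rw [norm_neg, norm_smul, hn, mul_one, Real.norm_eq_abs]
    have h6 : |s - s₀| ≤ |inner ℝ n (z - q)| + |inner ℝ n (p + w + s₀ • n - q)| := by
      have : s - s₀ = inner ℝ n (z - q) - inner ℝ n (p + w + s₀ • n - q) := by rw [h4]; ring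
      rw [this]
      exact abs_sub _ _
    rw [hdist]
    linarith
  refine ⟨?_, hlow⟩
  have hup : Metric.infDist z S ≤ |s| + K * ‖w‖ ^ 2 := by
    have h1 := Metric.infDist_le_dist_of_mem (x := z) hq₀
    have e1 : z - (p + w + s₀ • n) = (s - s₀) • n := by rw [hz, sub_smul]; abel
    rw [dist_eq_norm, e1, norm_smul, hn, mul_one, Real.norm_eq_abs] at h1
    have := abs_sub s s₀
    linarith
  set t := inner ℝ n (q - p) with ht
  set v := q - p - t • n with hv
  have hnv : inner ℝ n v = 0 := by
    rw [hv, inner_sub_right, inner_smul_right, real_inner_self_eq_norm_sq, hn, ← ht]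
    ring
  have hqv : q - p = v + t • n := by rw [hv]; abel
  have hqn : ‖q - p‖ ^ 2 = ‖v‖ ^ 2 + t ^ 2 := by rw [hqv, norm_add_smul_sq hn hnv]
  have ht1 : |t| ≤ K * (‖v‖ ^ 2 + t ^ 2) := by
    rw [← hqn]
    exact h.tangent q hq (by linarith)
  have ht2 : t ^ 2 ≤ 1 / 4 * (‖v‖ ^ 2 + t ^ 2) := by
    have := h.lipschitz q hq p hp (by linarith) (by simp; linarith)
    rw [← hqn, ← sq_abs]
    calc |t| ^ 2 ≤ (1 / 2 * ‖q - p‖) ^ 2 := by gcongr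
      _ = 1 / 4 * ‖q - p‖ ^ 2 := by ring
  have ht3 : |t| ≤ 2 * K * ‖v‖ ^ 2 := by nlinarith
  have hzq : z - q = (w - v) + (s - t) • n := by
    have : z - q = w + s • n - (q - p) := by rw [hz]; abel
    rw [this, hqv, sub_smul]
    abel
  have hnwv : inner ℝ n (w - v) = 0 := by rw [inner_sub_right, hw, hnv, sub_zero]
  have hD2 : Metric.infDist z S ^ 2 = ‖w - v‖ ^ 2 + (s - t) ^ 2 := by
    rw [hdist, hzq, norm_add_smul_sq hn hnwv]
  have hv2 : ‖v‖ ^ 2 ≤ 2 * (‖w‖ ^ 2 + ‖w - v‖ ^ 2) := by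
    have h1 : ‖v‖ ≤ ‖w‖ + ‖w - v‖ := by
      have := norm_sub_le w (w - v)
      rwa [sub_sub_cancel] at this
    nlinarith [sq_nonneg (‖w‖ - ‖w - v‖), norm_nonneg v]
  have hst : s ^ 2 - 2 * (|s| * |t|) ≤ (s - t) ^ 2 := by
    have := le_abs_self (s * t)
    rw [abs_mul] at this
    nlinarith [sq_nonneg t]
  have hs8 : 8 * K * |s| ≤ 1 := by
    have : 8 * K * |s| ≤ 8 * K * r := by gcongr
    linarith
  -- Expanding `D² = ‖w - v‖² + (s - t)²`, the cross term is at most `8K|s|(‖w‖² + ‖w - v‖²)`, and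
  -- its second part is absorbed by `‖w - v‖²` because `8K|s| ≤ 1`.
  have hfin : s ^ 2 - |s| * (8 * K * ‖w‖ ^ 2) ≤ Metric.infDist z S ^ 2 := by
    have h1 : |s| * |t| ≤ |s| * (2 * K * (2 * (‖w‖ ^ 2 + ‖w - v‖ ^ 2))) := by
      refine mul_le_mul_of_nonneg_left (ht3.trans ?_) (abs_nonneg s)
      exact mul_le_mul_of_nonneg_left hv2 (by linarith)
    have h2 : 8 * K * |s| * ‖w - v‖ ^ 2 ≤ 1 * ‖w - v‖ ^ 2 := by gcongr
    rw [hD2]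
    linarith
  have hD0 : 0 ≤ Metric.infDist z S := Metric.infDist_nonneg
  rw [abs_le]
  constructor
  · rcases le_total |s| (8 * K * ‖w‖ ^ 2) with hle | hle
    · linarith
    · have h1 : 0 ≤ 8 * K * ‖w‖ ^ 2 := by positivity
      have h2 : (|s| - 8 * K * ‖w‖ ^ 2) ^ 2 ≤ Metric.infDist z S ^ 2 := by
        rw [← sq_abs s] at hfin
        nlinarith
      have := abs_le_of_sq_le_sq h2 hD0
      linarith [le_abs_self (|s| - 8 * K * ‖w‖ ^ 2)]
  · have : 0 ≤ K * ‖w‖ ^ 2 := by positivity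
    linarith

/-- First variation: if `x - p` had a tangential part `w`, moving from `p` along the graph by `t •
w` would lower the squared distance by `2t‖w‖²`, at a cost of only `O(t²)`. -/
theorem IsGraphAt.sub_eq_smul {S : Set F} {K R : ℝ} {p n x : F} (hR : 0 < R) (hK : 0 ≤ K)
    (h : IsGraphAt S K R p n) (hmin : ∀ q ∈ S, ‖x - p‖ ≤ ‖x - q‖) :
    x - p = inner ℝ n (x - p) • n := by
  have hn := h.norm_eq_one
  set w := x - p - inner ℝ n (x - p) • n with hw
  have hnw : inner ℝ n w = 0 := by
    rw [hw, inner_sub_right, inner_smul_right, real_inner_self_eq_norm_sq, hn]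
    ring
  have hxw : inner ℝ (x - p) w = ‖w‖ ^ 2 := by
    have : x - p = w + inner ℝ n (x - p) • n := by rw [hw]; abel
    rw [this, inner_add_left, inner_smul_left, hnw, real_inner_self_eq_norm_sq]
    ring
  suffices hw0 : w = 0 by rwa [hw, sub_eq_zero] at hw0
  by_contra hw0
  have hwpos : 0 < ‖w‖ := norm_pos_iff.2 hw0
  set A := 2 * ‖x - p‖ * K * ‖w‖ ^ 2 + ‖w‖ ^ 2 + K ^ 2 * ‖w‖ ^ 4 with hA
  have key : ∀ t ∈ Ioo 0 (min 1 (R / ‖w‖)), 2 * ‖w‖ ^ 2 ≤ t * A := by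
    intro t ht
    have ht0 := ht.1
    have ht1 : t < 1 := ht.2.trans_le (min_le_left _ _)
    have ht2 : t * ‖w‖ < R := by
      rw [← lt_div_iff₀ hwpos]
      exact ht.2.trans_le (min_le_right _ _)
    have hntw : inner ℝ n (t • w) = 0 := by rw [inner_smul_right, hnw, mul_zero]
    have htw : ‖t • w‖ = t * ‖w‖ := by rw [norm_smul, Real.norm_of_nonneg ht0.le]
    obtain ⟨s, hs, hq⟩ := h.exists_height (t • w) hntw (by rwa [htw])
    rw [htw] at hs
    have h1 := hmin _ hq
    have e : x - (p + t • w + s • n) = (x - p) - (t • w + s • n) := by abel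
    have h2 : ‖x - p‖ ^ 2 ≤ ‖x - (p + t • w + s • n)‖ ^ 2 := by gcongr
    rw [e, norm_sub_sq_real (x - p), norm_add_smul_sq hn hntw, htw, inner_add_right, inner_smul_right,
      inner_smul_right, hxw] at h2
    have h3 : |inner ℝ (x - p) n| ≤ ‖x - p‖ := by
      have := abs_real_inner_le_norm (x - p) n
      rwa [hn, mul_one] at this
    have h4 : |s * inner ℝ (x - p) n| ≤ K * (t * ‖w‖) ^ 2 * ‖x - p‖ := by
      rw [abs_mul]
      gcongr
    have h5 : s ^ 2 ≤ (K * (t * ‖w‖) ^ 2) ^ 2 := by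
      rw [← sq_abs]
      gcongr
    have h6 : (K * (t * ‖w‖) ^ 2) ^ 2 ≤ t ^ 2 * (K ^ 2 * ‖w‖ ^ 4) := by
      have : t ^ 4 ≤ t ^ 2 := pow_le_pow_of_le_one ht0.le ht1.le (by norm_num)
      calc (K * (t * ‖w‖) ^ 2) ^ 2 = t ^ 4 * (K ^ 2 * ‖w‖ ^ 4) := by ring
        _ ≤ _ := by gcongr
    have h7 := (abs_le.1 h4).1
    have h8 : t * (2 * ‖w‖ ^ 2) ≤ t * (t * A) := by
      rw [hA]
      nlinarith
    exact le_of_mul_le_mul_left h8 ht0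
  have hlim : Tendsto (fun t : ℝ => t * A) (𝓝[>] 0) (𝓝 0) := by
    have : Tendsto (fun t : ℝ => t * A) (𝓝 0) (𝓝 (0 * A)) := (continuous_mul_const A).tendsto 0
    rw [zero_mul] at this
    exact this.mono_left nhdsWithin_le_nhds
  have := ge_of_tendsto hlim (b := 2 * ‖w‖ ^ 2) (by
    filter_upwards [Ioo_mem_nhdsGT (lt_min one_pos (div_pos hR hwpos))] with t ht using key t ht)
  nlinarith [sq_pos_of_pos hwpos]

/-- Near a compact `C²` hypersurface `S`, the distance to `S` is, up to a quadratic error, the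
distance to a tangent hyperplane, and it grows linearly in the direction of the normal. -/
theorem exists_infDist_expansion {S : Set F} (hS : IsCompact S) (hne : S.Nonempty)
    (h : ∃ K > 0, ∃ R > 0, ∀ p ∈ S, ∃ n, IsGraphAt S K R p n) :
    ∃ K > 0, ∃ r > 0, ∀ x, Metric.infDist x S < r → ∃ n, ‖n‖ = 1 ∧
      ∀ w, inner ℝ n w = 0 → ‖w‖ < r → ∃ s₀ : ℝ, |s₀| ≤ K * ‖w‖ ^ 2 ∧ ∀ t : ℝ, |t| < r →
        |Metric.infDist (x + w + t • n) S - abs (Metric.infDist x S + t)| ≤ K * ‖w‖ ^ 2 ∧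
        |Metric.infDist x S + t - s₀| / 3 ≤ Metric.infDist (x + w + t • n) S := by
  obtain ⟨K₀, hK₀, R, hR, hg⟩ := h
  set K := max K₀ 1 with hK
  have hK1 : 1 ≤ K := le_max_right _ _
  set r := min (R / 8) (1 / (8 * K)) with hr
  have hr0 : 0 < r := by positivity
  have hr1 : 8 * r ≤ R := by
    have : r ≤ R / 8 := min_le_left _ _
    linarith
  have hr2 : 8 * K * r ≤ 1 := by
    have : r ≤ 1 / (8 * K) := min_le_right _ _
    rwa [le_div_iff₀' (by positivity)] at this
  refine ⟨8 * K, by positivity, r / 2, by positivity, fun x hx => ?_⟩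
  obtain ⟨p, hp, hxp⟩ := hS.exists_infDist_eq_dist hne x
  obtain ⟨n₀, hn₀⟩ := hg p hp
  set ρ := Metric.infDist x S with hρ
  have hρ0 : 0 ≤ ρ := Metric.infDist_nonneg
  rw [dist_eq_norm] at hxp
  -- The sign of the normal is chosen so that `x` lies at height `+ρ`.
  obtain ⟨n, hn, hxn⟩ : ∃ n, IsGraphAt S K R p n ∧ x = p + ρ • n := by
    have hn₁ := hn₀.mono (K' := K) (le_max_left _ _) le_rfl
    have e := hn₁.sub_eq_smul hR (by linarith) (x := x) (fun q hq => by
      rw [← hxp, ← dist_eq_norm]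
      exact Metric.infDist_le_dist_of_mem hq)
    have e2 : ρ = |inner ℝ n₀ (x - p)| := by
      rw [hxp, e, norm_smul, hn₁.norm_eq_one, mul_one, Real.norm_eq_abs, inner_smul_right,
        real_inner_self_eq_norm_sq, hn₁.norm_eq_one, one_pow, mul_one]
    rcases abs_choice (inner ℝ n₀ (x - p)) with h1 | h1
    · exact ⟨n₀, hn₁, by rw [e2, h1, ← e]; abel⟩
    · exact ⟨-n₀, hn₁.neg, by rw [e2, h1, smul_neg, neg_smul, neg_neg, ← e]; abel⟩
  refine ⟨n, hn.norm_eq_one, fun w hw hwr => ?_⟩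
  obtain ⟨s₀, hs₀, hb⟩ := hn.infDist_bounds hS hK1 hp hr1 hr2 hw (by linarith)
  refine ⟨s₀, hs₀.trans (by gcongr; linarith), fun t ht => ?_⟩
  have e : x + w + t • n = p + w + (ρ + t) • n := by
    conv_lhs => rw [hxn]
    rw [add_smul]
    abel
  rw [e]
  refine hb (ρ + t) ?_
  have := abs_add_le ρ t
  rw [abs_of_nonneg hρ0] at this
  linarith

end Geometry

/-! ### Cylindrical coordinates -/

/-- The product carries the sup norm, so the map is factored through `WithLp 2`, where it is a
linear isometry between spaces of equal dimension and therefore preserves volume. -/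
theorem exists_frame {M : ℕ} {n : E (M + 1)} (hn : ‖n‖ = 1) :
    ∃ ι : E M →ₗᵢ[ℝ] E (M + 1), (∀ v, inner ℝ n (ι v) = 0) ∧
      MeasurableEmbedding (fun p : ℝ × E M => p.1 • n + ι p.2) ∧
      MeasurePreserving (fun p : ℝ × E M => p.1 • n + ι p.2) := by
  have : Fact (Module.finrank ℝ (E (M + 1)) = M + 1) := ⟨by simp⟩
  have hn0 : n ≠ 0 := norm_ne_zero_iff.1 (by rw [hn]; exact one_ne_zero)
  set b := OrthonormalBasis.fromOrthogonalSpanSingleton (𝕜 := ℝ) M hn0 with hb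
  set ι : E M →ₗᵢ[ℝ] E (M + 1) :=
    (ℝ ∙ n)ᗮ.subtypeₗᵢ.comp b.repr.symm.toLinearIsometry with hι
  have hperp : ∀ v, inner ℝ n (ι v) = 0 := fun v =>
    Submodule.mem_orthogonal_singleton_iff_inner_right.1 (b.repr.symm v).2
  set Λ : WithLp 2 (ℝ × E M) →ₗ[ℝ] E (M + 1) :=
    ((LinearMap.toSpanSingleton ℝ (E (M + 1)) n).coprod ι.toLinearMap) ∘ₗ
      (WithLp.linearEquiv 2 ℝ (ℝ × E M)).toLinearMap with hΛ
  have hΛn : ∀ p, ‖Λ p‖ = ‖p‖ := by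
    intro p
    have h1 : Λ p = ι p.snd + p.fst • n := by
      simp [hΛ, add_comm]
    have h2 : ‖Λ p‖ ^ 2 = ‖p‖ ^ 2 := by
      rw [h1, norm_add_smul_sq hn (hperp _), ι.norm_map, WithLp.prod_norm_sq_eq_of_L2,
        Real.norm_eq_abs, sq_abs, add_comm]
    exact (sq_eq_sq₀ (norm_nonneg _) (norm_nonneg _)).1 h2
  set Φ : WithLp 2 (ℝ × E M) →ₗᵢ[ℝ] E (M + 1) := ⟨Λ, hΛn⟩ with hΦ
  set Ψ := Φ.toLinearIsometryEquiv (by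
    rw [LinearEquiv.finrank_eq (WithLp.linearEquiv 2 ℝ (ℝ × E M))]
    simp [add_comm]) with hΨ
  have e : (fun p : ℝ × E M => p.1 • n + ι p.2) = Ψ ∘ (WithLp.toLp 2) := by
    funext p
    simp [hΨ, hΦ, hΛ]
  refine ⟨ι, hperp, ?_, ?_⟩
  · rw [e]
    exact Ψ.toHomeomorph.measurableEmbedding.comp
      (MeasurableEquiv.toLp 2 (ℝ × E M)).measurableEmbedding
  · rw [e]
    exact Ψ.measurePreserving.comp (WithLp.volume_preserving_toLp ℝ (E M))

theorem norm_smul_add_sq {M : ℕ} {n : E (M + 1)} (hn : ‖n‖ = 1) {ι : E M →ₗᵢ[ℝ] E (M + 1)}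
    (hι : ∀ v, inner ℝ n (ι v) = 0) (t : ℝ) (v : E M) :
    ‖t • n + ι v‖ ^ 2 = t ^ 2 + ‖v‖ ^ 2 := by
  rw [add_comm (t • n), norm_add_smul_sq hn (hι v), ι.norm_map, add_comm]

theorem inner_smul_add {M : ℕ} {n : E (M + 1)} (hn : ‖n‖ = 1) {ι : E M →ₗᵢ[ℝ] E (M + 1)}
    (hι : ∀ v, inner ℝ n (ι v) = 0) (t : ℝ) (v : E M) : inner ℝ n (t • n + ι v) = t := by
  rw [inner_add_right, hι, inner_smul_right, real_inner_self_eq_norm_sq, hn]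
  ring

/-! ### The fractional Laplacian of a power of the distance to a hyperplane -/

/-- The integral of the kernel over hyperplanes, normalised at distance one from the origin. -/
noncomputable def kernelMass (M : ℕ) (β : ℝ) : ℝ := ∫ v : E M, (1 + ‖v‖ ^ 2) ^ (-β / 2)

/-- The condition `M < β` guarantees convergence; a divergent integral would have the default value
`0`. -/
theorem kernelMass_pos {M : ℕ} {β : ℝ} (hβ : (M : ℝ) < β) : 0 < kernelMass M β := by
  have hi : Integrable (fun v : E M => (1 + ‖v‖ ^ 2) ^ (-β / 2)) :=
    integrable_rpow_neg_one_add_norm_sq (by simpa using hβ)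
  refine (integral_pos_iff_support_of_nonneg (fun v => by positivity) hi).2 ?_
  have : Function.support (fun v : E M => (1 + ‖v‖ ^ 2) ^ (-β / 2)) = univ := by
    ext v
    simpa using (by positivity : (1 + ‖v‖ ^ 2) ^ (-β / 2) ≠ 0)
  rw [this]
  exact isOpen_univ.measure_pos _ univ_nonempty

theorem kernel_slice {M : ℕ} {β : ℝ} {n : E (M + 1)} (hn : ‖n‖ = 1) {ι : E M →ₗᵢ[ℝ] E (M + 1)}
    (hι : ∀ v, inner ℝ n (ι v) = 0) {t : ℝ} (ht : t ≠ 0) (v : E M) :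
    (‖t • n + ι v‖ ^ β)⁻¹ = |t| ^ (-β) * (1 + ‖|t|⁻¹ • v‖ ^ 2) ^ (-β / 2) := by
  have ht0 : 0 < |t| := abs_pos.2 ht
  have h1 : ‖t • n + ι v‖ = |t| * (1 + ‖|t|⁻¹ • v‖ ^ 2) ^ (1 / 2 : ℝ) := by
    rw [← Real.sqrt_eq_rpow, ← Real.sqrt_sq (norm_nonneg (t • n + ι v)),
      norm_smul_add_sq hn hι, ← Real.sqrt_sq ht0.le, ← Real.sqrt_mul (by positivity),
      norm_smul, norm_inv, Real.norm_eq_abs, Real.sqrt_sq (by positivity), abs_abs]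
    congr 1
    rw [mul_pow, inv_pow, sq_abs, mul_add, mul_one, mul_inv_cancel_left₀ (by positivity)]
  rw [h1, Real.mul_rpow ht0.le (by positivity), mul_inv, ← Real.rpow_neg ht0.le,
    ← Real.rpow_mul (by positivity), ← Real.rpow_neg (by positivity)]
  congr 2
  ring

theorem integrable_kernel_slice {M : ℕ} {β : ℝ} (hβ : (M : ℝ) < β) {n : E (M + 1)} (hn : ‖n‖ = 1)
    {ι : E M →ₗᵢ[ℝ] E (M + 1)} (hι : ∀ v, inner ℝ n (ι v) = 0) {t : ℝ} (ht : t ≠ 0) :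
    Integrable (fun v : E M => (‖t • n + ι v‖ ^ β)⁻¹) := by
  simp_rw [kernel_slice hn hι ht]
  refine Integrable.const_mul ?_ _
  have hi : Integrable (fun v : E M => (1 + ‖v‖ ^ 2) ^ (-β / 2)) :=
    integrable_rpow_neg_one_add_norm_sq (by simpa using hβ)
  exact hi.comp_smul (inv_ne_zero (abs_ne_zero.2 ht))

/-- Rescaling `v` by `|t|` gives the homogeneity. For `β = M + 1 + 2α` the exponent is `-1 - 2α`,
the kernel of the one-dimensional problem. -/
theorem integral_kernel_slice {M : ℕ} (β : ℝ) {n : E (M + 1)} (hn : ‖n‖ = 1)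
    {ι : E M →ₗᵢ[ℝ] E (M + 1)} (hι : ∀ v, inner ℝ n (ι v) = 0) {t : ℝ} (ht : t ≠ 0) :
    ∫ v : E M, (‖t • n + ι v‖ ^ β)⁻¹ = |t| ^ ((M : ℝ) - β) * kernelMass M β := by
  have ht0 : 0 < |t| := abs_pos.2 ht
  simp_rw [kernel_slice hn hι ht]
  rw [integral_const_mul, Measure.integral_comp_smul volume
    (fun v : E M => (1 + ‖v‖ ^ 2) ^ (-β / 2)), ← kernelMass, smul_eq_mul, finrank_euclideanSpace,
    Fintype.card_fin, inv_pow, inv_inv, abs_pow, abs_abs, ← mul_assoc, ← Real.rpow_natCast,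
    ← Real.rpow_add ht0]
  congr 2
  ring

theorem integrable_comp_abs {f : ℝ → ℝ} (hf : IntegrableOn f (Ioi 0)) :
    Integrable fun t => f |t| := by
  have h1 : IntegrableOn (fun t => f |t|) (Ioi 0) :=
    hf.congr_fun (fun t ht => by rw [abs_of_pos ht]) measurableSet_Ioi
  have h2 : IntegrableOn (fun t => f |t|) (Iio 0) := by
    have := ((Measure.measurePreserving_neg (volume : Measure ℝ)).integrableOn_comp_preimage
      (MeasurableEquiv.neg ℝ).measurableEmbedding).2 hf
    refine (this.congr_fun (fun t ht => ?_) (measurableSet_Ioi.preimage measurable_neg)).mono_set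
      (fun t ht => by simpa using ht)
    have : t < 0 := by simpa using ht
    simp [abs_of_neg this]
  rw [← integrableOn_univ, ← Iio_union_Ici (a := (0 : ℝ))]
  exact h2.union ((integrableOn_Ici_iff_integrableOn_Ioi).2 h1)

theorem flat_profile {α τ ρ : ℝ} (hρ : 0 < ρ) {t : ℝ} (ht : 0 < t) :
    (|ρ + ρ * t| ^ τ + |ρ - ρ * t| ^ τ - 2 * ρ ^ τ) * (ρ * t) ^ (-1 - 2 * α) =
      ρ ^ (τ - 2 * α - 1) * ((|1 - t| ^ τ + (1 + t) ^ τ - 2) / t ^ (1 + 2 * α)) := by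
  have e1 : |ρ + ρ * t| = ρ * (1 + t) := by rw [abs_of_pos (by positivity)]; ring
  have e2 : |ρ - ρ * t| = ρ * |1 - t| := by
    rw [show ρ - ρ * t = ρ * (1 - t) by ring, abs_mul, abs_of_pos hρ]
  rw [e1, e2, Real.mul_rpow hρ.le (by positivity), Real.mul_rpow hρ.le (abs_nonneg _),
    Real.mul_rpow hρ.le ht.le, show τ - 2 * α - 1 = τ + (-1 - 2 * α) by ring, Real.rpow_add hρ,
    div_eq_mul_inv, ← Real.rpow_neg ht.le, show -(1 + 2 * α) = -1 - 2 * α by ring]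
  ring

theorem integrable_flat_profile {α τ ρ : ℝ} (hα : α ∈ Ioo (0 : ℝ) 1) (hτ : τ ∈ Ioo (-1 : ℝ) 0)
    (hρ : 0 < ρ) :
    IntegrableOn (fun t => (|ρ + t| ^ τ + |ρ - t| ^ τ - 2 * ρ ^ τ) * t ^ (-1 - 2 * α)) (Ioi 0) := by
  have h := integrableOn_Ioi_comp_mul_left_iff
    (fun t => (|ρ + t| ^ τ + |ρ - t| ^ τ - 2 * ρ ^ τ) * t ^ (-1 - 2 * α)) 0 hρ
  rw [mul_zero] at h
  refine h.1 ?_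
  refine IntegrableOn.congr_fun ?_ (fun t ht => (flat_profile hρ ht).symm) measurableSet_Ioi
  exact (integrableOn_c hα ⟨hτ.1, by linarith [hτ.2, hα.1]⟩).const_mul _

theorem integral_flat_profile {α τ ρ : ℝ} (hρ : 0 < ρ) :
    ∫ t in Ioi 0, (|ρ + t| ^ τ + |ρ - t| ^ τ - 2 * ρ ^ τ) * t ^ (-1 - 2 * α) =
      ρ ^ (τ - 2 * α) * c α τ := by
  have h := integral_comp_mul_left_Ioi
    (fun t => (|ρ + t| ^ τ + |ρ - t| ^ τ - 2 * ρ ^ τ) * t ^ (-1 - 2 * α)) 0 hρ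
  rw [mul_zero, setIntegral_congr_fun measurableSet_Ioi (fun t ht => flat_profile hρ ht),
    integral_const_mul, smul_eq_mul, inv_mul_eq_div, eq_div_iff hρ.ne'] at h
  rw [← h, c, Real.rpow_sub_one hρ.ne']
  field_simp

/-- Apart from the kernel, the integrand depends on `⟨n, y⟩` alone, so Fubini and
`integral_kernel_slice` leave a one-dimensional integral. It is even in `t`, whence the factor `2`,
and its half is `c` rescaled by `ρ`. -/
theorem flat_integral {M : ℕ} {α τ ρ : ℝ} (hα : α ∈ Ioo (0 : ℝ) 1) (hτ : τ ∈ Ioo (-1 : ℝ) 0)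
    (hρ : 0 < ρ) {n : E (M + 1)} (hn : ‖n‖ = 1) :
    Integrable (fun y : E (M + 1) => (|ρ + inner ℝ n y| ^ τ + |ρ - inner ℝ n y| ^ τ - 2 * ρ ^ τ) /
      ‖y‖ ^ (((M + 1 : ℕ) : ℝ) + 2 * α)) ∧
    ∫ y : E (M + 1), (|ρ + inner ℝ n y| ^ τ + |ρ - inner ℝ n y| ^ τ - 2 * ρ ^ τ) /
      ‖y‖ ^ (((M + 1 : ℕ) : ℝ) + 2 * α) =
      2 * kernelMass M (((M + 1 : ℕ) : ℝ) + 2 * α) * c α τ * ρ ^ (τ - 2 * α) := by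
  set β := ((M + 1 : ℕ) : ℝ) + 2 * α with hβ
  have hMβ : (M : ℝ) - β = -1 - 2 * α := by rw [hβ]; push_cast; ring
  have hβM : (M : ℝ) < β := by linarith [hα.1]
  obtain ⟨ι, hι, hemb, hmp⟩ := exists_frame hn
  set H : ℝ → ℝ := fun t => |ρ + t| ^ τ + |ρ - t| ^ τ - 2 * ρ ^ τ with hH
  have hHabs : ∀ t, H |t| = H t := by
    intro t
    rcases abs_choice t with h | h <;> rw [h]
    simp only [hH, sub_neg_eq_add, ← sub_eq_add_neg]
    ring
  set g : E (M + 1) → ℝ := fun y => H (inner ℝ n y) / ‖y‖ ^ β with hg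
  have hgΨ : ∀ (t : ℝ) (v : E M), g (t • n + ι v) = H t * (‖t • n + ι v‖ ^ β)⁻¹ := by
    intro t v
    simp only [hg]
    rw [inner_smul_add hn hι, div_eq_mul_inv]
  have hgm : Measurable g := by
    simp only [hg, hH]
    fun_prop
  have hint1 : Integrable (fun t : ℝ => H t * |t| ^ (-1 - 2 * α)) := by
    have := integrable_comp_abs (integrable_flat_profile hα hτ hρ)
    refine this.congr (ae_of_all _ fun t => ?_)
    change H |t| * _ = _
    rw [hHabs]
  have hne : ∀ᵐ t : ℝ, t ≠ 0 := Measure.ae_ne volume 0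
  have hΨ : Integrable (fun p : ℝ × E M => g (p.1 • n + ι p.2)) (volume.prod volume) := by
    have hm : AEStronglyMeasurable (fun p : ℝ × E M => g (p.1 • n + ι p.2)) (volume.prod volume) :=
      (hgm.comp hemb.measurable).aestronglyMeasurable
    refine (integrable_prod_iff hm).2 ?_
    constructor
    · filter_upwards [hne] with t ht
      simp only [hgΨ]
      exact (integrable_kernel_slice hβM hn hι ht).const_mul _
    · refine (hint1.norm.mul_const (kernelMass M β)).congr ?_
      filter_upwards [hne] with t ht
      simp only [hgΨ, norm_mul, norm_inv, Real.norm_of_nonneg (Real.rpow_nonneg (norm_nonneg _) _)]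
      rw [integral_const_mul, integral_kernel_slice β hn hι ht, hMβ,
        Real.norm_of_nonneg (Real.rpow_nonneg (abs_nonneg _) _)]
      ring
  refine ⟨(hmp.integrable_comp_emb hemb).1 hΨ, ?_⟩
  change ∫ y, g y = _
  rw [← hmp.integral_comp hemb, Measure.volume_eq_prod, integral_prod _ hΨ]
  have e : ∀ᵐ t : ℝ, ∫ v : E M, g (t • n + ι v) =
      (fun t => H t * t ^ (-1 - 2 * α) * kernelMass M β) |t| := by
    filter_upwards [hne] with t ht
    simp only [hgΨ]
    rw [integral_const_mul, integral_kernel_slice β hn hι ht, hMβ, hHabs]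
    ring
  have e2 := integral_comp_abs (f := fun t => H t * t ^ (-1 - 2 * α) * kernelMass M β)
  refine ((integral_congr_ae e).trans e2).trans ?_
  rw [integral_mul_const, integral_flat_profile hρ]
  ring

/-! ### Comparison of a function with a power of the distance to a hyperplane -/

/-- The difference between `u (x + ·)` and the power `τ` of the distance to the hyperplane at
distance `ρ` below `x` with unit normal `n`, weighted with the kernel of the fractional Laplacian. -/
noncomputable def flatError {N : ℕ} (α τ : ℝ) (u : E N → ℝ) (x n : E N) (ρ : ℝ) (y : E N) : ℝ :=
  (u (x + y) - |ρ + inner ℝ n y| ^ τ) / ‖y‖ ^ ((N : ℝ) + 2 * α)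

theorem measurable_flatError {N : ℕ} {α τ : ℝ} {u : E N → ℝ} (hu : Measurable u) (x n : E N)
    (ρ : ℝ) : Measurable (flatError α τ u x n ρ) := by
  unfold flatError
  fun_prop

theorem lintegral_comp_inv_smul {F : Type*} [NormedAddCommGroup F] [NormedSpace ℝ F]
    [MeasurableSpace F] [BorelSpace F] [FiniteDimensional ℝ F] (μ : Measure F) [μ.IsAddHaarMeasure]
    {f : F → ENNReal} (hf : Measurable f) {R : ℝ} (hR : 0 < R) :
    ∫⁻ y, f (R⁻¹ • y) ∂μ = ENNReal.ofReal (R ^ Module.finrank ℝ F) * ∫⁻ y, f y ∂μ := by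
  rw [← lintegral_map hf (measurable_const_smul R⁻¹), Measure.map_addHaar_smul μ
    (inv_ne_zero hR.ne'), lintegral_smul_measure, inv_pow, inv_inv, abs_of_pos (by positivity),
    smul_eq_mul]

theorem abs_rpow_sub_rpow_le {τ m a b : ℝ} (hτ : τ ∈ Ioo (-1 : ℝ) 0) (hm : 0 < m) (ha : m ≤ a)
    (hb : m ≤ b) : |a ^ τ - b ^ τ| ≤ m ^ (τ - 1) * |a - b| := by
  have := (convex_Ici m).norm_image_sub_le_of_norm_hasDerivWithin_le
    (f := fun t : ℝ => t ^ τ) (f' := fun t => τ * t ^ (τ - 1)) (C := m ^ (τ - 1)) (x := b) (y := a)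
    ?_ ?_ hb ha
  · simpa only [Real.norm_eq_abs] using this
  · intro t ht
    exact (Real.hasDerivAt_rpow_const (Or.inl (hm.trans_le ht).ne')).hasDerivWithinAt
  · intro t ht
    have h1 : 0 < t ^ (τ - 1) := Real.rpow_pos_of_pos (hm.trans_le ht) _
    have h2 : t ^ (τ - 1) ≤ m ^ (τ - 1) :=
      Real.rpow_le_rpow_of_nonpos hm ht (by linarith [hτ.2])
    rw [Real.norm_eq_abs, abs_mul, abs_of_pos h1, abs_of_neg hτ.2]
    nlinarith [hτ.1, hτ.2]

theorem abs_le_norm_of_unit {F : Type*} [NormedAddCommGroup F] [InnerProductSpace ℝ F] {n : F}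
    (hn : ‖n‖ = 1) (y : F) : |inner ℝ n y| ≤ ‖y‖ := by
  have := abs_real_inner_le_norm n y
  rwa [hn, one_mul] at this

/-- In this ball both distances are at least `ρ / 4`, so the mean value theorem bounds the
difference of powers by a multiple of `ρ^(τ-1) ‖y‖²`. The substitution `y = ρ η` then gives the
power of `ρ`. -/
theorem lintegral_flatError_near_le (M : ℕ) {α τ : ℝ} (hα : α ∈ Ioo (0 : ℝ) 1)
    (hτ : τ ∈ Ioo (-1 : ℝ) 0) {K : ℝ} (hK : 0 < K) :
    ∃ C : ℝ, 0 ≤ C ∧ ∀ (u : E (M + 1) → ℝ) (x n : E (M + 1)) (ρ : ℝ), ‖n‖ = 1 → 0 < ρ →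
      K * ρ ≤ 1 →
      (∀ y, ‖y‖ < ρ / 2 → ∃ δ : ℝ, u (x + y) = δ ^ τ ∧ |δ - abs (ρ + inner ℝ n y)| ≤ K * ‖y‖ ^ 2) →
      ∫⁻ y in Metric.ball 0 (ρ / 2), ‖flatError α τ u x n ρ y‖ₑ ≤
        ENNReal.ofReal (C * ρ ^ (τ + 1 - 2 * α)) := by
  set β : ℝ := ((M + 1 : ℕ) : ℝ) + 2 * α with hβ
  set f : E (M + 1) → ENNReal :=
    (Metric.ball 0 (1 / 2)).indicator fun η => ENNReal.ofReal (‖η‖ ^ (2 - β)) with hf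
  have hfm : Measurable f := Measurable.indicator (by fun_prop) Metric.isOpen_ball.measurableSet
  have hfin : ∫⁻ η, f η ≠ ⊤ := by
    rw [hf, lintegral_indicator Metric.isOpen_ball.measurableSet]
    have := integrableOn_ball_of_norm_le_rpow (E := E (M + 1)) (μ := volume) (C := 1)
      (f := fun η => ‖η‖ ^ (2 - β)) (α := β - 2) (r := 1 / 2) (by simp)
      (by simp [hβ]; linarith [hα.2])
      (ae_of_all _ fun η => by
        rw [Real.norm_of_nonneg (Real.rpow_nonneg (norm_nonneg _) _), one_mul, neg_sub])
      (Measurable.aestronglyMeasurable (by fun_prop))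
    have h2 := this.lintegral_lt_top
    exact h2.ne
  refine ⟨(1 / 4) ^ (τ - 1) * K * (∫⁻ η, f η).toReal, by positivity,
    fun u x n ρ hn hρ hKρ hu => ?_⟩
  have hpt : ∀ y ∈ Metric.ball (0 : E (M + 1)) (ρ / 2), ‖flatError α τ u x n ρ y‖ₑ ≤
      ENNReal.ofReal ((1 / 4) ^ (τ - 1) * K * ρ ^ (τ - 1 + (2 - β))) * f (ρ⁻¹ • y) := by
    intro y hy
    rw [mem_ball_zero_iff] at hy
    obtain ⟨δ, hδ, hb⟩ := hu y hy
    have hin := abs_le.1 (abs_le_norm_of_unit hn y)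
    have hs : 0 < ρ + inner ℝ n y := by linarith [hin.1]
    rw [abs_of_pos hs] at hb
    have hy0 := norm_nonneg y
    have hKy : K * ‖y‖ ^ 2 ≤ ρ / 4 := by
      have h1 : ‖y‖ ^ 2 ≤ (ρ / 2) ^ 2 := by gcongr
      nlinarith
    have hb' := abs_le.1 hb
    have hd := abs_rpow_sub_rpow_le (m := ρ / 4) (a := δ) (b := ρ + inner ℝ n y) hτ (by positivity)
      (by linarith [hin.1, hb'.1]) (by linarith [hin.1])
    have hmem : ρ⁻¹ • y ∈ Metric.ball (0 : E (M + 1)) (1 / 2) := by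
      rw [mem_ball_zero_iff, norm_smul, norm_inv, Real.norm_of_nonneg hρ.le, inv_mul_lt_iff₀ hρ]
      linarith
    rw [hf, indicator_of_mem hmem, ← ENNReal.ofReal_mul (by positivity), ← ofReal_norm]
    refine ENNReal.ofReal_le_ofReal ?_
    rw [flatError, hδ, abs_of_pos hs, norm_div,
      Real.norm_of_nonneg (Real.rpow_nonneg (norm_nonneg _) _), Real.norm_eq_abs]
    -- At `y = 0` the kernel is a division by `0 ^ β = 0`, and the quotient is `0`.
    rcases hy0.eq_or_lt with h0 | h0
    · have hβ0 : β ≠ 0 := by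
        rw [hβ]
        have := hα.1
        positivity
      rw [← h0, ← hβ, Real.zero_rpow hβ0, div_zero]
      positivity
    rw [div_le_iff₀ (Real.rpow_pos_of_pos h0 _), norm_smul, norm_inv, Real.norm_of_nonneg hρ.le,
      Real.mul_rpow (by positivity) hy0, Real.inv_rpow hρ.le, ← Real.rpow_neg hρ.le, ← hβ]
    have e1 : ‖y‖ ^ (2 - β) * ‖y‖ ^ β = ‖y‖ ^ 2 := by
      rw [← Real.rpow_add h0, sub_add_cancel, Real.rpow_two]
    have e2 : ρ ^ (τ - 1 + (2 - β)) * ρ ^ (-(2 - β)) = ρ ^ (τ - 1) := by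
      rw [← Real.rpow_add hρ]
      congr 1
      ring
    calc |δ ^ τ - (ρ + inner ℝ n y) ^ τ| ≤ (ρ / 4) ^ (τ - 1) * (K * ‖y‖ ^ 2) :=
          hd.trans (by gcongr)
      _ = (1 / 4) ^ (τ - 1) * K * ρ ^ (τ - 1) * ‖y‖ ^ 2 := by
          rw [show ρ / 4 = 1 / 4 * ρ by ring, Real.mul_rpow (by norm_num) hρ.le]
          ring
      _ = _ := by rw [← e1, ← e2]; ring
  refine (setLIntegral_mono' Metric.isOpen_ball.measurableSet hpt).trans ?_
  refine (setLIntegral_le_lintegral _ _).trans ?_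
  have hfs : Measurable fun y => f (ρ⁻¹ • y) := hfm.comp (measurable_const_smul ρ⁻¹)
  rw [lintegral_const_mul _ hfs,
    lintegral_comp_inv_smul volume hfm hρ, ← mul_assoc, ← ENNReal.ofReal_mul (by positivity)]
  conv_lhs => rw [← ENNReal.ofReal_toReal hfin]
  rw [← ENNReal.ofReal_mul (by positivity)]
  refine ENNReal.ofReal_le_ofReal (le_of_eq ?_)
  have e3 : ρ ^ (τ + 1 - 2 * α) = ρ ^ (τ - 1 + (2 - β)) * ρ ^ (M + 1) := by
    rw [← Real.rpow_natCast, ← Real.rpow_add hρ]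
    congr 1
    rw [hβ]
    ring
  rw [finrank_euclideanSpace, Fintype.card_fin, e3]
  ring

/-- An integrable majorant, at unit scale, for the difference of two powers. -/
noncomputable def powerProfile (τ σ : ℝ) : ENNReal :=
  ENNReal.ofReal (16 * (1 + ‖σ‖) ^ (-(1 - τ))) +
    ENNReal.ofReal (3 * (Ioo (-4 : ℝ) 4).indicator (fun t => |t| ^ τ) σ)

theorem measurable_powerProfile (τ : ℝ) : Measurable (powerProfile τ) := by
  have : Measurable ((Ioo (-4 : ℝ) 4).indicator (fun t => |t| ^ τ)) :=
    Measurable.indicator (by fun_prop) measurableSet_Ioo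
  unfold powerProfile
  fun_prop

theorem lintegral_powerProfile_ne_top {τ : ℝ} (hτ : τ ∈ Ioo (-1 : ℝ) 0) :
    ∫⁻ σ, powerProfile τ σ ≠ ⊤ := by
  unfold powerProfile
  rw [lintegral_add_left (by fun_prop)]
  refine ENNReal.add_ne_top.2 ⟨?_, ?_⟩
  · have : Integrable (fun σ : ℝ => (1 + ‖σ‖) ^ (-(1 - τ))) :=
      integrable_one_add_norm (by simp; linarith [hτ.2])
    exact (this.const_mul 16).lintegral_lt_top.ne
  · have : Integrable ((Ioo (-4 : ℝ) 4).indicator (fun t => |t| ^ τ)) :=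
      (integrable_indicator_iff measurableSet_Ioo).2 (integrableOn_abs_rpow hτ.1 4)
    exact (this.const_mul 3).lintegral_lt_top.ne

theorem rpow_le_three_mul_rpow {τ a δ : ℝ} (hτ : τ ∈ Ioo (-1 : ℝ) 0) (ha : 0 < a)
    (hδ : a / 3 ≤ δ) : δ ^ τ ≤ 3 * a ^ τ := by
  calc δ ^ τ ≤ (a / 3) ^ τ := Real.rpow_le_rpow_of_nonpos (by positivity) hδ hτ.2.le
    _ = (1 / 3) ^ τ * a ^ τ := by
        rw [← Real.mul_rpow (by norm_num) ha.le]
        congr 1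
        ring
    _ ≤ 3 * a ^ τ := by
        gcongr
        calc (1 / 3 : ℝ) ^ τ ≤ (1 / 3 : ℝ) ^ (-1 : ℝ) :=
              Real.rpow_le_rpow_of_exponent_ge (by norm_num) (by norm_num) hτ.1.le
          _ = 3 := by rw [Real.rpow_neg_one]; norm_num

/-- For `|s| > 2ε` the mean value theorem gives decay of order `|s|^(τ-1)`, integrable at infinity
since `τ < 0`. For `|s| ≤ 2ε` the two powers are bounded separately by singularities at `0` and at
`s₀`, integrable since `τ > -1`. After scaling by `ε` the majorant no longer depends on `ε`. -/
theorem abs_rpow_sub_le_profile {τ ε s s₀ δ : ℝ} (hτ : τ ∈ Ioo (-1 : ℝ) 0) (hε : 0 < ε)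
    (hs₀ : |s₀| ≤ ε) (hss : s ≠ s₀) (hδ : |δ - abs s| ≤ ε) (hδ' : |s - s₀| / 3 ≤ δ) :
    ‖δ ^ τ - |s| ^ τ‖ₑ ≤
      ENNReal.ofReal (ε ^ τ) * (powerProfile τ (ε⁻¹ * s) + powerProfile τ (ε⁻¹ * (s - s₀))) := by
  have hετ : 0 < ε ^ τ := Real.rpow_pos_of_pos hε _
  have hscale : ∀ t : ℝ, |t| ^ τ = ε ^ τ * |ε⁻¹ * t| ^ τ := fun t => by
    rw [← Real.mul_rpow hε.le (abs_nonneg _), abs_mul, abs_of_pos (inv_pos.2 hε),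
      mul_inv_cancel_left₀ hε.ne']
  have hδ2 := abs_le.1 hδ
  rw [← ofReal_norm, Real.norm_eq_abs]
  rcases lt_or_ge (2 * ε) |s| with h | h
  · have hd := abs_rpow_sub_rpow_le (m := |s| / 2) (a := δ) (b := |s|) hτ (by linarith)
      (by linarith [hδ2.1]) (by linarith)
    have h1 : |δ ^ τ - |s| ^ τ| ≤ ε ^ τ * (16 * (1 + ‖ε⁻¹ * s‖) ^ (-(1 - τ))) := by
      have e1 : |s| = ε * ‖ε⁻¹ * s‖ := by
        rw [Real.norm_eq_abs, abs_mul, abs_of_pos (inv_pos.2 hε), mul_inv_cancel_left₀ hε.ne']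
      set σ := ‖ε⁻¹ * s‖ with hσ
      have hσ2 : 2 < σ := by nlinarith
      calc |δ ^ τ - |s| ^ τ| ≤ (|s| / 2) ^ (τ - 1) * ε := hd.trans (by gcongr)
        _ = ε ^ τ * (σ / 2) ^ (τ - 1) := by
            rw [e1, mul_div_assoc, Real.mul_rpow hε.le (by positivity), Real.rpow_sub_one hε.ne']
            field_simp
        _ ≤ ε ^ τ * ((1 + σ) / 4) ^ (τ - 1) := by
            gcongr ε ^ τ * ?_
            exact Real.rpow_le_rpow_of_nonpos (by positivity) (by linarith) (by linarith [hτ.2])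
        _ = ε ^ τ * ((1 / 4) ^ (τ - 1) * (1 + σ) ^ (-(1 - τ))) := by
            rw [show (1 + σ) / 4 = 1 / 4 * (1 + σ) by ring,
              Real.mul_rpow (by norm_num) (by positivity), neg_sub]
        _ ≤ ε ^ τ * (16 * (1 + σ) ^ (-(1 - τ))) := by
            gcongr
            calc (1 / 4 : ℝ) ^ (τ - 1) ≤ (1 / 4 : ℝ) ^ (-2 : ℝ) :=
                  Real.rpow_le_rpow_of_exponent_ge (by norm_num) (by norm_num) (by linarith [hτ.1])
              _ = 16 := by
                  rw [Real.rpow_neg (by norm_num), Real.rpow_two]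
                  norm_num
    refine (ENNReal.ofReal_le_ofReal h1).trans ?_
    rw [ENNReal.ofReal_mul hετ.le]
    gcongr
    exact le_add_right (le_add_right le_rfl)
  · have hpos : 0 < |s - s₀| := abs_pos.2 (sub_ne_zero.2 hss)
    have hδ0 : 0 < δ := by linarith
    have hs3 : |s - s₀| ≤ 3 * ε := (abs_sub s s₀).trans (by linarith)
    have hmem : ∀ t : ℝ, |t| ≤ 3 * ε → ε⁻¹ * t ∈ Ioo (-4 : ℝ) 4 := fun t ht => by
      refine abs_lt.1 ?_
      rw [abs_mul, abs_of_pos (inv_pos.2 hε), inv_mul_lt_iff₀ hε]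
      linarith
    have hprof : ∀ t : ℝ, |t| ≤ 3 * ε →
        ENNReal.ofReal (3 * |t| ^ τ) ≤ ENNReal.ofReal (ε ^ τ) * powerProfile τ (ε⁻¹ * t) := by
      intro t ht
      have e : 3 * |t| ^ τ = ε ^ τ * (3 * |ε⁻¹ * t| ^ τ) := by rw [hscale t]; ring
      rw [e, ENNReal.ofReal_mul hετ.le, powerProfile, indicator_of_mem (hmem t ht)]
      gcongr
      exact le_add_left le_rfl
    have h1 := rpow_le_three_mul_rpow hτ hpos hδ'
    have hs0 : 0 ≤ |s| ^ τ := Real.rpow_nonneg (abs_nonneg _) _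
    have h2 : |δ ^ τ - |s| ^ τ| ≤ 3 * |s| ^ τ + 3 * |s - s₀| ^ τ := by
      have := Real.rpow_nonneg hδ0.le τ
      rw [abs_le]
      constructor <;> linarith
    refine (ENNReal.ofReal_le_ofReal h2).trans ?_
    rw [ENNReal.ofReal_add (by positivity) (by positivity), mul_add]
    exact add_le_add (hprof s (by linarith)) (hprof _ hs3)

/-- The difference of two powers of functions that differ by at most `ε`. -/
theorem lintegral_rpow_sub_le {τ : ℝ} (hτ : τ ∈ Ioo (-1 : ℝ) 0) {ε s₀ : ℝ} (hε : 0 < ε)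
    (hs₀ : |s₀| ≤ ε) {δ : ℝ → ℝ} {T : Set ℝ} (hT : MeasurableSet T)
    (hδ : ∀ s ∈ T, |δ s - abs s| ≤ ε ∧ |s - s₀| / 3 ≤ δ s) :
    ∫⁻ s in T, ‖δ s ^ τ - |s| ^ τ‖ₑ ≤
      ENNReal.ofReal (2 * (∫⁻ σ, powerProfile τ σ).toReal * ε ^ (1 + τ)) := by
  have hm := measurable_powerProfile τ
  have hb : ∀ᵐ s ∂(volume.restrict T), ‖δ s ^ τ - |s| ^ τ‖ₑ ≤
      ENNReal.ofReal (ε ^ τ) * (powerProfile τ (ε⁻¹ * s) + powerProfile τ (ε⁻¹ * (s - s₀))) := by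
    filter_upwards [ae_restrict_mem hT, ae_restrict_of_ae (Measure.ae_ne volume s₀)] with s h1 h2
    exact abs_rpow_sub_le_profile hτ hε hs₀ h2 (hδ s h1).1 (hδ s h1).2
  refine (lintegral_mono_ae hb).trans ((setLIntegral_le_lintegral _ _).trans ?_)
  have e1 : ∫⁻ s, powerProfile τ (ε⁻¹ * s) = ENNReal.ofReal ε * ∫⁻ σ, powerProfile τ σ := by
    have := lintegral_comp_inv_smul (volume : Measure ℝ) hm hε
    simpa using this
  have e2 : ∫⁻ s, powerProfile τ (ε⁻¹ * (s - s₀)) = ENNReal.ofReal ε * ∫⁻ σ, powerProfile τ σ := by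
    rw [← e1]
    exact lintegral_sub_right_eq_self (fun s => powerProfile τ (ε⁻¹ * s)) s₀
  rw [lintegral_const_mul _ (by fun_prop), lintegral_add_left (by fun_prop), e1, e2]
  conv_lhs => rw [← ENNReal.ofReal_toReal (lintegral_powerProfile_ne_top hτ)]
  have := Real.rpow_pos_of_pos hε τ
  rw [← ENNReal.ofReal_mul hε.le, ← ENNReal.ofReal_add (by positivity) (by positivity),
    ← ENNReal.ofReal_mul this.le, Real.rpow_add hε, Real.rpow_one]
  exact ENNReal.ofReal_le_ofReal (le_of_eq (by ring))

/-- Scaling by `ρ` leaves an integral cut off at the origin, convergent at infinity because `e < 0`.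
-/
theorem lintegral_max_norm_rpow (M : ℕ) {e : ℝ} (he : e < 0) :
    ∃ C : ℝ, 0 ≤ C ∧ ∀ ρ : ℝ, 0 < ρ →
      ∫⁻ v : E M, ENNReal.ofReal (max ‖v‖ (ρ / 2) ^ (e - M)) ≤ ENNReal.ofReal (C * ρ ^ e) := by
  set f : E M → ENNReal := fun η => ENNReal.ofReal (max ‖η‖ (1 / 2) ^ (e - M)) with hf
  have hfm : Measurable f := by fun_prop
  have hM0 : (0 : ℝ) ≤ M := M.cast_nonneg
  have hfin : ∫⁻ η, f η ≠ ⊤ := by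
    have hi : Integrable (fun η : E M => (1 / 3 : ℝ) ^ (e - M) * (1 + ‖η‖) ^ (-(M - e))) :=
      (integrable_one_add_norm (by simp; linarith)).const_mul _
    refine (lt_of_le_of_lt (lintegral_mono fun η => ?_) hi.lintegral_lt_top).ne
    refine ENNReal.ofReal_le_ofReal ?_
    rw [neg_sub, ← Real.mul_rpow (by norm_num) (by positivity)]
    refine Real.rpow_le_rpow_of_nonpos (by positivity) ?_ (by linarith)
    rcases le_total ‖η‖ (1 / 2) with h | h
    · exact le_max_of_le_right (by linarith)
    · exact le_max_of_le_left (by linarith)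
  refine ⟨(∫⁻ η, f η).toReal, by positivity, fun ρ hρ => ?_⟩
  have hpt : ∀ v : E M, ENNReal.ofReal (max ‖v‖ (ρ / 2) ^ (e - M)) =
      ENNReal.ofReal (ρ ^ (e - M)) * f (ρ⁻¹ • v) := by
    intro v
    have h1 : max ‖v‖ (ρ / 2) = ρ * max ‖ρ⁻¹ • v‖ (1 / 2) := by
      rw [mul_max_of_nonneg _ _ hρ.le, norm_smul, norm_inv, Real.norm_of_nonneg hρ.le,
        mul_inv_cancel_left₀ hρ.ne']
      ring_nf
    rw [hf, ← ENNReal.ofReal_mul (by positivity), h1, Real.mul_rpow hρ.le (by positivity)]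
  have hfs : Measurable fun y => f (ρ⁻¹ • y) := hfm.comp (measurable_const_smul ρ⁻¹)
  simp_rw [hpt]
  rw [lintegral_const_mul _ hfs, lintegral_comp_inv_smul volume hfm hρ, ← mul_assoc,
    ← ENNReal.ofReal_mul (by positivity)]
  conv_lhs => rw [← ENNReal.ofReal_toReal hfin]
  rw [← ENNReal.ofReal_mul (by positivity)]
  refine ENNReal.ofReal_le_ofReal (le_of_eq ?_)
  rw [finrank_euclideanSpace, Fintype.card_fin, ← Real.rpow_natCast, ← Real.rpow_add hρ,
    sub_add_cancel]
  ring

/-- The local expansion of `u = δ ^ τ` near `x`: on the segments orthogonal to the hyperplane,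
`δ` is quadratically close to the distance to the hyperplane and grows linearly. -/
def HasFlatExpansion {N : ℕ} (τ K r : ℝ) (u : E N → ℝ) (x n : E N) (ρ : ℝ) : Prop :=
  ∀ w, inner ℝ n w = 0 → ‖w‖ < r → ∃ s₀ : ℝ, |s₀| ≤ K * ‖w‖ ^ 2 ∧ ∀ t : ℝ, |t| < r →
    ∃ δ : ℝ, u (x + (t • n + w)) = δ ^ τ ∧ |δ - abs (ρ + t)| ≤ K * ‖w‖ ^ 2 ∧
      |ρ + t - s₀| / 3 ≤ δ

theorem abs_le_norm_smul_add {M : ℕ} {n : E (M + 1)} (hn : ‖n‖ = 1) {ι : E M →ₗᵢ[ℝ] E (M + 1)}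
    (hι : ∀ v, inner ℝ n (ι v) = 0) (t : ℝ) (v : E M) : |t| ≤ ‖t • n + ι v‖ := by
  have := abs_le_norm_of_unit hn (t • n + ι v)
  rwa [inner_smul_add hn hι] at this

theorem norm_le_norm_smul_add {M : ℕ} {n : E (M + 1)} (hn : ‖n‖ = 1)
    {ι : E M →ₗᵢ[ℝ] E (M + 1)} (hι : ∀ v, inner ℝ n (ι v) = 0) (t : ℝ) (v : E M) :
    ‖v‖ ≤ ‖t • n + ι v‖ := by
  refine (sq_le_sq₀ (norm_nonneg _) (norm_nonneg _)).1 ?_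
  rw [norm_smul_add_sq hn hι]
  nlinarith [sq_nonneg t]

theorem lintegral_frame {M : ℕ} {n : E (M + 1)} {ι : E M →ₗᵢ[ℝ] E (M + 1)}
    (hemb : MeasurableEmbedding (fun p : ℝ × E M => p.1 • n + ι p.2))
    (hmp : MeasurePreserving (fun p : ℝ × E M => p.1 • n + ι p.2))
    {f : E (M + 1) → ENNReal} (hf : Measurable f) :
    ∫⁻ y, f y = ∫⁻ v : E M, ∫⁻ t : ℝ, f (t • n + ι v) := by
  rw [← hmp.lintegral_comp_emb hemb, Measure.volume_eq_prod]
  exact lintegral_prod_symm _ (hf.comp hemb.measurable).aemeasurable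

/-- On the line through `v`, put `μ = max ‖v‖ (ρ/2)`. Outside the small ball the kernel is at most
`μ^(-β)`, and `lintegral_rpow_sub_le` with `ε = K μ²` gives `μ^(2+2τ)`. Together this is
`μ^(2τ-2α+1-M)`, which is then integrated over `v`. -/
theorem lintegral_flatError_mid_le (M : ℕ) {α τ : ℝ} (hα : α ∈ Ioo (0 : ℝ) 1)
    (hτ : τ ∈ Ioo (-1 : ℝ) 0) {K r : ℝ} (hK : 0 < K) (hr1 : r ≤ 1) {e : ℝ} (he : e < 0)
    (he' : e ≤ 2 * τ - 2 * α + 1) :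
    ∃ C : ℝ, 0 ≤ C ∧ ∀ (u : E (M + 1) → ℝ) (x n : E (M + 1)) (ρ : ℝ), Measurable u → ‖n‖ = 1 →
      0 < ρ → ρ ≤ 1 → HasFlatExpansion τ K r u x n ρ →
      ∫⁻ y in Metric.ball 0 r \ Metric.ball 0 (ρ / 2), ‖flatError α τ u x n ρ y‖ₑ ≤
        ENNReal.ofReal (C * ρ ^ e) := by
  set β : ℝ := ((M + 1 : ℕ) : ℝ) + 2 * α with hβ
  have hβ0 : 0 ≤ β := by
    have := hα.1
    positivity
  obtain ⟨C₀, hC₀, hmax⟩ := lintegral_max_norm_rpow M he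
  set P := (∫⁻ σ, powerProfile τ σ).toReal with hP
  have hP0 : 0 ≤ P := ENNReal.toReal_nonneg
  refine ⟨2 * P * K ^ (1 + τ) * C₀, by positivity, fun u x n ρ hum hn hρ hρ1 hu => ?_⟩
  obtain ⟨ι, hι, hemb, hmp⟩ := exists_frame hn
  have hS : MeasurableSet (Metric.ball (0 : E (M + 1)) r \ Metric.ball 0 (ρ / 2)) :=
    Metric.isOpen_ball.measurableSet.diff Metric.isOpen_ball.measurableSet
  have hFm : Measurable fun y => ‖flatError α τ u x n ρ y‖ₑ :=
    (measurable_flatError hum x n ρ).enorm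
  rw [← lintegral_indicator hS, lintegral_frame hemb hmp (hFm.indicator hS)]
  have hpt : ∀ v : E M, ∫⁻ t : ℝ, (Metric.ball (0 : E (M + 1)) r \ Metric.ball 0 (ρ / 2)).indicator
      (fun y => ‖flatError α τ u x n ρ y‖ₑ) (t • n + ι v) ≤
      ENNReal.ofReal (2 * P * K ^ (1 + τ)) * ENNReal.ofReal (max ‖v‖ (ρ / 2) ^ (e - M)) := by
    intro v
    rcases le_or_gt r ‖v‖ with hv | hv
    · have : ∀ t : ℝ, (Metric.ball (0 : E (M + 1)) r \ Metric.ball 0 (ρ / 2)).indicator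
          (fun y => ‖flatError α τ u x n ρ y‖ₑ) (t • n + ι v) = 0 := fun t => by
        refine indicator_of_notMem (fun h => ?_) _
        have h1 := mem_ball_zero_iff.1 h.1
        linarith [norm_le_norm_smul_add hn hι t v]
      simp [this]
    set μ := max ‖v‖ (ρ / 2) with hμ
    have hμ0 : 0 < μ := lt_max_of_lt_right (by linarith)
    have hμ1 : μ ≤ 1 := max_le (by linarith) (by linarith)
    obtain ⟨s₀, hs₀, hexp⟩ := hu (ι v) (hι v) (by rwa [ι.norm_map])
    rw [ι.norm_map] at hs₀ hexp
    have hvμ : K * ‖v‖ ^ 2 ≤ K * μ ^ 2 := by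
      gcongr
      exact le_max_left _ _
    -- The variable `s = ρ + t` measures height from the hyperplane, so the flat power is singular
    -- at `s = 0`.
    have hex : ∀ s : ℝ, |s - ρ| < r → ∃ δ : ℝ, u (x + ((s - ρ) • n + ι v)) = δ ^ τ ∧
        |δ - abs s| ≤ K * μ ^ 2 ∧ |s - s₀| / 3 ≤ δ := fun s hs => by
      obtain ⟨δ, h1, h2, h3⟩ := hexp (s - ρ) hs
      rw [add_sub_cancel] at h2 h3
      exact ⟨δ, h1, h2.trans hvμ, h3⟩
    choose! δ hδ1 hδ2 hδ3 using hex
    have hT : MeasurableSet {s : ℝ | |s - ρ| < r} :=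
      measurableSet_lt (by fun_prop) measurable_const
    have hline := lintegral_rpow_sub_le hτ (ε := K * μ ^ 2) (s₀ := s₀) (by positivity)
      (hs₀.trans hvμ) (δ := δ) hT (fun s hs => ⟨hδ2 s hs, hδ3 s hs⟩)
    have hslice : ∀ t : ℝ, (Metric.ball (0 : E (M + 1)) r \ Metric.ball 0 (ρ / 2)).indicator
        (fun y => ‖flatError α τ u x n ρ y‖ₑ) (t • n + ι v) ≤
        ENNReal.ofReal (μ ^ (-β)) *
          ({s : ℝ | |s - ρ| < r}.indicator (fun s => ‖δ s ^ τ - |s| ^ τ‖ₑ)) (t + ρ) := by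
      intro t
      by_cases hmem : t • n + ι v ∈ Metric.ball (0 : E (M + 1)) r \ Metric.ball 0 (ρ / 2)
      · rw [indicator_of_mem hmem]
        have h1 := mem_ball_zero_iff.1 hmem.1
        have h2 : ρ / 2 ≤ ‖t • n + ι v‖ := by simpa using hmem.2
        have ht : |t + ρ - ρ| < r := by
          rw [add_sub_cancel_right]
          exact (abs_le_norm_smul_add hn hι t v).trans_lt h1
        have hμy : μ ≤ ‖t • n + ι v‖ := max_le (norm_le_norm_smul_add hn hι t v) h2
        rw [indicator_of_mem (by exact ht), ← ofReal_norm, ← ofReal_norm, ← ENNReal.ofReal_mul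
          (by positivity)]
        refine ENNReal.ofReal_le_ofReal ?_
        have h3 := hδ1 _ ht
        rw [add_sub_cancel_right] at h3
        rw [flatError, h3, inner_smul_add hn hι, norm_div,
          Real.norm_of_nonneg (Real.rpow_nonneg (norm_nonneg _) _), div_eq_inv_mul,
          ← Real.rpow_neg (norm_nonneg _), ← hβ, add_comm ρ t]
        exact mul_le_mul_of_nonneg_right
          (Real.rpow_le_rpow_of_nonpos hμ0 hμy (neg_nonpos.2 hβ0)) (norm_nonneg _)
      · rw [indicator_of_notMem hmem]
        exact zero_le
    refine (lintegral_mono hslice).trans ?_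
    rw [lintegral_const_mul' _ _ ENNReal.ofReal_ne_top,
      lintegral_add_right_eq_self ({s : ℝ | |s - ρ| < r}.indicator
        (fun s => ‖δ s ^ τ - |s| ^ τ‖ₑ)) ρ, lintegral_indicator hT]
    refine (mul_le_mul_right hline _).trans ?_
    rw [← ENNReal.ofReal_mul (by positivity), ← ENNReal.ofReal_mul (by positivity)]
    refine ENNReal.ofReal_le_ofReal ?_
    have e1 : (K * μ ^ 2) ^ (1 + τ) = K ^ (1 + τ) * μ ^ (2 * (1 + τ)) := by
      rw [Real.mul_rpow hK.le (by positivity), ← Real.rpow_natCast μ 2, ← Real.rpow_mul hμ0.le]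
      norm_num
    -- Since `μ ≤ 1`, lowering the exponent to `e - M` only enlarges the bound, and it brings in the
    -- negative `e` needed for integration over all `v`.
    have e2 : μ ^ (-β) * μ ^ (2 * (1 + τ)) ≤ μ ^ (e - M) := by
      rw [← Real.rpow_add hμ0]
      refine Real.rpow_le_rpow_of_exponent_ge hμ0 hμ1 ?_
      rw [hβ]
      push_cast
      linarith
    calc μ ^ (-β) * (2 * P * (K * μ ^ 2) ^ (1 + τ))
        = 2 * P * K ^ (1 + τ) * (μ ^ (-β) * μ ^ (2 * (1 + τ))) := by rw [e1]; ring
      _ ≤ _ := by gcongr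
  refine (lintegral_mono hpt).trans ?_
  rw [lintegral_const_mul' _ _ ENNReal.ofReal_ne_top]
  refine (mul_le_mul_right (hmax ρ hρ) _).trans ?_
  rw [← ENNReal.ofReal_mul (by positivity)]
  exact ENNReal.ofReal_le_ofReal (le_of_eq (by ring))

theorem inv_add_one_rpow_le {r s β : ℝ} (hr : 0 < r) (hs : r ≤ s) (hβ : 0 ≤ β) :
    s ^ (-β) ≤ (r⁻¹ + 1) ^ β * (1 + s) ^ (-β) := by
  have hs0 : 0 < s := hr.trans_le hs
  have h : 1 + s ≤ (r⁻¹ + 1) * s := by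
    have : 1 ≤ r⁻¹ * s := by
      rw [inv_mul_eq_div, le_div_iff₀ hr]
      linarith
    linarith
  rw [Real.rpow_neg hs0.le, Real.rpow_neg (by positivity), ← div_eq_mul_inv, inv_eq_one_div,
    div_le_div_iff₀ (by positivity) (by positivity), one_mul, ← Real.mul_rpow (by positivity) hs0.le]
  exact Real.rpow_le_rpow (by positivity) h hβ

/-- Away from the origin the kernel is dominated by a product, with `β` split as `(M + α) + (1 +
α)`. In the normal direction the singularity at `t = -ρ` is integrable, and translation invariance
makes the bound independent of `ρ`. -/
theorem lintegral_flat_tail_le (M : ℕ) {α τ : ℝ} (hα : α ∈ Ioo (0 : ℝ) 1)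
    (hτ : τ ∈ Ioo (-1 : ℝ) 0) {r : ℝ} (hr : 0 < r) :
    ∃ C : ℝ, 0 ≤ C ∧ ∀ (n : E (M + 1)) (ρ : ℝ), ‖n‖ = 1 →
      ∫⁻ y in (Metric.ball 0 r)ᶜ, ENNReal.ofReal (|ρ + inner ℝ n y| ^ τ *
        ‖y‖ ^ (-(((M + 1 : ℕ) : ℝ) + 2 * α))) ≤ ENNReal.ofReal C := by
  set β : ℝ := ((M + 1 : ℕ) : ℝ) + 2 * α with hβ
  have hα0 := hα.1
  have hβ0 : 0 ≤ β := by positivity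
  set a : E M → ENNReal := fun v => ENNReal.ofReal ((1 + ‖v‖) ^ (-(M + α))) with ha
  have hafin : ∫⁻ v, a v ≠ ⊤ := by
    have : Integrable (fun v : E M => (1 + ‖v‖) ^ (-(M + α))) :=
      integrable_one_add_norm (by simp [hα0])
    exact this.lintegral_lt_top.ne
  set b : ℝ → ENNReal := fun t => ENNReal.ofReal ((1 + ‖t‖) ^ (-(1 + α))) with hb
  have hbm : Measurable b := by fun_prop
  have hbfin : ∫⁻ t, b t ≠ ⊤ := by
    have : Integrable (fun t : ℝ => (1 + ‖t‖) ^ (-(1 + α))) :=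
      integrable_one_add_norm (by simp [hα0])
    exact this.lintegral_lt_top.ne
  set q : ℝ → ENNReal := (Ioo (-1 : ℝ) 1).indicator fun s => ENNReal.ofReal (|s| ^ τ) with hq
  have hqm : Measurable q := Measurable.indicator (by fun_prop) measurableSet_Ioo
  have hqfin : ∫⁻ s, q s ≠ ⊤ := by
    rw [hq, lintegral_indicator measurableSet_Ioo]
    have := (integrableOn_abs_rpow hτ.1 1).lintegral_lt_top
    exact this.ne
  set k := (r⁻¹ + 1) ^ β with hk
  set C := ENNReal.ofReal k * ((∫⁻ s, q s) + ∫⁻ t, b t) * ∫⁻ v, a v with hC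
  have hCfin : C ≠ ⊤ := by finiteness
  refine ⟨C.toReal, ENNReal.toReal_nonneg, fun n ρ hn => ?_⟩
  rw [ENNReal.ofReal_toReal hCfin]
  obtain ⟨ι, hι, hemb, hmp⟩ := exists_frame hn
  have hS : MeasurableSet (Metric.ball (0 : E (M + 1)) r)ᶜ :=
    Metric.isOpen_ball.measurableSet.compl
  have hFm : Measurable fun y : E (M + 1) =>
      ENNReal.ofReal (|ρ + inner ℝ n y| ^ τ * ‖y‖ ^ (-β)) := by fun_prop
  rw [← lintegral_indicator hS, lintegral_frame hemb hmp (hFm.indicator hS)]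
  have hpt : ∀ (v : E M) (t : ℝ), (Metric.ball (0 : E (M + 1)) r)ᶜ.indicator
      (fun y => ENNReal.ofReal (|ρ + inner ℝ n y| ^ τ * ‖y‖ ^ (-β))) (t • n + ι v) ≤
      ENNReal.ofReal k * a v * (q (t + ρ) + b t) := by
    intro v t
    by_cases hmem : t • n + ι v ∈ (Metric.ball (0 : E (M + 1)) r)ᶜ
    swap
    · rw [indicator_of_notMem hmem]
      exact zero_le
    rw [indicator_of_mem hmem, inner_smul_add hn hι]
    set y := t • n + ι v with hy
    have hyr : r ≤ ‖y‖ := by simpa using hmem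
    have hy0 : 0 < ‖y‖ := hr.trans_le hyr
    have h1 : (‖y‖) ^ (-β) ≤ k * (1 + ‖y‖) ^ (-β) := inv_add_one_rpow_le hr hyr hβ0
    have h3 : (1 + ‖y‖) ^ (-β) ≤ (1 + ‖v‖) ^ (-(M + α)) * (1 + ‖t‖) ^ (-(1 + α)) := by
      have e : -β = -(M + α) + -(1 + α) := by rw [hβ]; push_cast; ring
      rw [e, Real.rpow_add (by positivity)]
      gcongr ?_ * ?_
      · refine Real.rpow_le_rpow_of_nonpos (by positivity) ?_ (neg_nonpos.2 (by positivity))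
        linarith [norm_le_norm_smul_add hn hι t v]
      · refine Real.rpow_le_rpow_of_nonpos (by positivity) ?_ (neg_nonpos.2 (by positivity))
        rw [Real.norm_eq_abs t]
        linarith [abs_le_norm_smul_add hn hι t v]
    have h4 : ENNReal.ofReal (|ρ + t| ^ τ * (1 + ‖t‖) ^ (-(1 + α))) ≤ q (t + ρ) + b t := by
      rw [add_comm ρ t]
      have hb1 : (1 + ‖t‖) ^ (-(1 + α)) ≤ 1 :=
        Real.rpow_le_one_of_one_le_of_nonpos (by linarith [norm_nonneg t]) (by linarith)
      have hb0 : 0 ≤ (1 + ‖t‖) ^ (-(1 + α)) := by positivity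
      have hq0 : 0 ≤ |t + ρ| ^ τ := Real.rpow_nonneg (abs_nonneg _) _
      by_cases h : t + ρ ∈ Ioo (-1 : ℝ) 1
      · rw [hq, indicator_of_mem h]
        refine le_add_right (ENNReal.ofReal_le_ofReal ?_)
        exact mul_le_of_le_one_right hq0 hb1
      · refine le_add_left (ENNReal.ofReal_le_ofReal ?_)
        refine mul_le_of_le_one_left hb0 ?_
        refine Real.rpow_le_one_of_one_le_of_nonpos ?_ hτ.2.le
        by_contra h5
        exact h (abs_lt.1 (not_le.1 h5))
    have hq0 : 0 ≤ |ρ + t| ^ τ := Real.rpow_nonneg (abs_nonneg _) _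
    calc ENNReal.ofReal (|ρ + t| ^ τ * ‖y‖ ^ (-β))
        ≤ ENNReal.ofReal (k * (1 + ‖v‖) ^ (-(M + α)) * (|ρ + t| ^ τ * (1 + ‖t‖) ^ (-(1 + α)))) := by
          refine ENNReal.ofReal_le_ofReal ?_
          calc |ρ + t| ^ τ * ‖y‖ ^ (-β) ≤ |ρ + t| ^ τ *
                (k * ((1 + ‖v‖) ^ (-(M + α)) * (1 + ‖t‖) ^ (-(1 + α)))) := by
                gcongr
                exact h1.trans (by gcongr)
            _ = _ := by ring
      _ = ENNReal.ofReal k * a v * ENNReal.ofReal (|ρ + t| ^ τ * (1 + ‖t‖) ^ (-(1 + α))) := by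
          rw [ENNReal.ofReal_mul (by positivity), ENNReal.ofReal_mul (by positivity)]
      _ ≤ _ := by gcongr
  refine (lintegral_mono fun v => lintegral_mono (hpt v)).trans ?_
  have hin : ∀ v, ∫⁻ t, ENNReal.ofReal k * a v * (q (t + ρ) + b t) =
      ENNReal.ofReal k * ((∫⁻ s, q s) + ∫⁻ t, b t) * a v := by
    intro v
    rw [lintegral_const_mul' _ _ (by finiteness), lintegral_add_right _ hbm,
      lintegral_add_right_eq_self q ρ]
    ring
  simp_rw [hin]
  rw [lintegral_const_mul' _ _ (by finiteness)]

/-! ### Total error of the flat comparison, and absolute convergence -/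

theorem HasFlatExpansion.near {N : ℕ} {τ K r : ℝ} {u : E N → ℝ} {x n : E N} {ρ : ℝ}
    (h : HasFlatExpansion τ K r u x n ρ) (hK : 0 ≤ K) (hn : ‖n‖ = 1) {y : E N} (hy : ‖y‖ < r) :
    ∃ δ : ℝ, u (x + y) = δ ^ τ ∧ |δ - abs (ρ + inner ℝ n y)| ≤ K * ‖y‖ ^ 2 := by
  set w := y - inner ℝ n y • n with hw
  have hnw : inner ℝ n w = 0 := by
    rw [hw, inner_sub_right, inner_smul_right, real_inner_self_eq_norm_sq, hn]
    ring
  have hyw : y = w + inner ℝ n y • n := by rw [hw]; abel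
  have hsq := norm_add_smul_sq hn hnw (inner ℝ n y)
  rw [← hyw] at hsq
  have hwy : ‖w‖ ≤ ‖y‖ := by
    refine (sq_le_sq₀ (norm_nonneg _) (norm_nonneg _)).1 ?_
    nlinarith [sq_nonneg (inner ℝ n y)]
  obtain ⟨s₀, -, hexp⟩ := h w hnw (hwy.trans_lt hy)
  obtain ⟨δ, h1, h2, -⟩ := hexp (inner ℝ n y) ((abs_le_norm_of_unit hn y).trans_lt hy)
  refine ⟨δ, ?_, h2.trans (by gcongr)⟩
  rwa [add_comm (inner ℝ n y • n), ← hyw] at h1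

/-- Taking the minimum with `τ` makes the exponent negative even when `2τ - 2α + 1 ≥ 0`, so the
bounded tail is absorbed; the near part is smaller because `2τ - 2α + 1 < τ + 1 - 2α`. -/
theorem lintegral_flatError_le (M : ℕ) {α τ : ℝ} (hα : α ∈ Ioo (0 : ℝ) 1)
    (hτ : τ ∈ Ioo (-1 : ℝ) 0) {K r : ℝ} (hK : 0 < K) (hr : 0 < r) (hr1 : r ≤ 1)
    {u : E (M + 1) → ℝ} (hum : Measurable u) (hui : Integrable u) :
    ∃ C : ℝ, 0 ≤ C ∧ ∀ (x n : E (M + 1)) (ρ : ℝ), ‖n‖ = 1 → 0 < ρ → ρ ≤ r → K * ρ ≤ 1 →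
      HasFlatExpansion τ K r u x n ρ →
      ∫⁻ y, ‖flatError α τ u x n ρ y‖ₑ ≤
        ENNReal.ofReal (C * ρ ^ min τ (2 * τ - 2 * α + 1)) := by
  set e := min τ (2 * τ - 2 * α + 1) with he
  have he0 : e < 0 := (min_le_left _ _).trans_lt hτ.2
  have he1 : e ≤ 2 * τ - 2 * α + 1 := min_le_right _ _
  obtain ⟨C₁, hC₁, h₁⟩ := lintegral_flatError_near_le M hα hτ hK
  obtain ⟨C₂, hC₂, h₂⟩ := lintegral_flatError_mid_le M hα hτ hK hr1 he0 he1
  obtain ⟨C₃, hC₃, h₃⟩ := lintegral_flat_tail_le M hα hτ hr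
  set β : ℝ := ((M + 1 : ℕ) : ℝ) + 2 * α with hβ
  have hβ0 : 0 ≤ β := by
    have := hα.1
    positivity
  set I := (∫⁻ y, ‖u y‖ₑ).toReal with hI
  have hI0 : 0 ≤ I := ENNReal.toReal_nonneg
  refine ⟨C₁ + C₂ + (r ^ (-β) * I + C₃), by positivity, fun x n ρ hn hρ hρr hKρ hu => ?_⟩
  have hρ1 : ρ ≤ 1 := hρr.trans hr1
  have hρe : 1 ≤ ρ ^ e := Real.one_le_rpow_of_pos_of_le_one_of_nonpos hρ hρ1 he0.le
  have b₁ := h₁ u x n ρ hn hρ hKρ fun y hy => hu.near hK.le hn (hy.trans (by linarith))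
  have b₂ := h₂ u x n ρ hum hn hρ hρ1 hu
  have hFm : Measurable fun y => ‖flatError α τ u x n ρ y‖ₑ :=
    (measurable_flatError hum x n ρ).enorm
  have b₃ : ∫⁻ y in (Metric.ball 0 r)ᶜ, ‖flatError α τ u x n ρ y‖ₑ ≤
      ENNReal.ofReal (r ^ (-β) * I + C₃) := by
    have hpt : ∀ y ∈ (Metric.ball (0 : E (M + 1)) r)ᶜ, ‖flatError α τ u x n ρ y‖ₑ ≤
        ENNReal.ofReal (r ^ (-β)) * ‖u (x + y)‖ₑ +
          ENNReal.ofReal (|ρ + inner ℝ n y| ^ τ * ‖y‖ ^ (-β)) := by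
      intro y hy
      have hyr : r ≤ ‖y‖ := by simpa using hy
      have hq0 : 0 ≤ |ρ + inner ℝ n y| ^ τ := Real.rpow_nonneg (abs_nonneg _) _
      rw [← ofReal_norm, ← ofReal_norm, ← ENNReal.ofReal_mul (by positivity),
        ← ENNReal.ofReal_add (by positivity) (by positivity)]
      refine ENNReal.ofReal_le_ofReal ?_
      rw [flatError, norm_div, Real.norm_of_nonneg (Real.rpow_nonneg (norm_nonneg y) _),
        div_eq_mul_inv, ← Real.rpow_neg (norm_nonneg _), ← hβ]
      have h5 : ‖y‖ ^ (-β) ≤ r ^ (-β) :=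
        Real.rpow_le_rpow_of_nonpos hr hyr (neg_nonpos.2 hβ0)
      have h6 : 0 ≤ ‖y‖ ^ (-β) := by positivity
      have h7 := norm_sub_le (u (x + y)) (|ρ + inner ℝ n y| ^ τ)
      rw [Real.norm_of_nonneg hq0] at h7
      calc _ ≤ (‖u (x + y)‖ + |ρ + inner ℝ n y| ^ τ) * ‖y‖ ^ (-β) := by gcongr
        _ = ‖y‖ ^ (-β) * ‖u (x + y)‖ + |ρ + inner ℝ n y| ^ τ * ‖y‖ ^ (-β) := by ring
        _ ≤ _ := by gcongr
    refine (setLIntegral_mono' Metric.isOpen_ball.measurableSet.compl hpt).trans ?_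
    rw [lintegral_add_left (by fun_prop), ENNReal.ofReal_add (by positivity) hC₃]
    refine add_le_add ?_ (h₃ n ρ hn)
    refine (setLIntegral_le_lintegral _ _).trans ?_
    rw [lintegral_const_mul' _ _ ENNReal.ofReal_ne_top,
      lintegral_add_left_eq_self (fun y => ‖u y‖ₑ) x, ENNReal.ofReal_mul (by positivity), hI,
      ENNReal.ofReal_toReal hui.2.ne]
  have hcover : ∫⁻ y, ‖flatError α τ u x n ρ y‖ₑ ≤
      (∫⁻ y in Metric.ball 0 (ρ / 2), ‖flatError α τ u x n ρ y‖ₑ) +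
      (∫⁻ y in Metric.ball 0 r \ Metric.ball 0 (ρ / 2), ‖flatError α τ u x n ρ y‖ₑ) +
      ∫⁻ y in (Metric.ball 0 r)ᶜ, ‖flatError α τ u x n ρ y‖ₑ := by
    rw [← setLIntegral_univ]
    refine (lintegral_mono_set (t := (Metric.ball (0 : E (M + 1)) (ρ / 2) ∪
      (Metric.ball 0 r \ Metric.ball 0 (ρ / 2))) ∪ (Metric.ball 0 r)ᶜ) fun y _ => ?_).trans ?_
    · by_cases h1 : y ∈ Metric.ball (0 : E (M + 1)) (ρ / 2)
      · exact Or.inl (Or.inl h1)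
      · by_cases h2 : y ∈ Metric.ball (0 : E (M + 1)) r
        · exact Or.inl (Or.inr ⟨h2, h1⟩)
        · exact Or.inr h2
    · refine (lintegral_union_le _ _ _).trans ?_
      gcongr
      exact lintegral_union_le _ _ _
  refine hcover.trans ((add_le_add (add_le_add b₁ b₂) b₃).trans ?_)
  rw [← ENNReal.ofReal_add (by positivity) (by positivity),
    ← ENNReal.ofReal_add (by positivity) (by positivity)]
  refine ENNReal.ofReal_le_ofReal ?_
  have h8 : ρ ^ (τ + 1 - 2 * α) ≤ ρ ^ e :=
    Real.rpow_le_rpow_of_exponent_ge hρ hρ1 (by linarith [hτ.2])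
  have h9 : r ^ (-β) * I + C₃ ≤ (r ^ (-β) * I + C₃) * ρ ^ e :=
    le_mul_of_one_le_right (by positivity) hρe
  have h10 : C₁ * ρ ^ (τ + 1 - 2 * α) ≤ C₁ * ρ ^ e := by gcongr
  calc _ ≤ C₁ * ρ ^ e + C₂ * ρ ^ e + (r ^ (-β) * I + C₃) * ρ ^ e :=
        add_le_add (add_le_add h10 le_rfl) h9
    _ = _ := by ring

/-- The fractional Laplacian of `u` at `x` compared with that of the power `τ` of the distance to a
hyperplane. -/
theorem abs_fracLaplacian_add_le {M : ℕ} {α τ ρ : ℝ} (hα : α ∈ Ioo (0 : ℝ) 1)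
    (hτ : τ ∈ Ioo (-1 : ℝ) 0) (hρ : 0 < ρ) {u : E (M + 1) → ℝ} {x n : E (M + 1)} (hn : ‖n‖ = 1)
    (hum : Measurable u) (hui : Integrable (fracIntegrand α u x)) (hux : u x = ρ ^ τ)
    {b : ℝ} (hb : 0 ≤ b)
    (herr : ∫⁻ y, ‖flatError α τ u x n ρ y‖ₑ ≤ ENNReal.ofReal b) :
    |fracLaplacian α u x +
      kernelMass M (((M + 1 : ℕ) : ℝ) + 2 * α) * c α τ * ρ ^ (τ - 2 * α)| ≤ b := by
  obtain ⟨hGi, hG⟩ := flat_integral (M := M) hα hτ hρ hn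
  set G := fun y : E (M + 1) => (|ρ + inner ℝ n y| ^ τ + |ρ - inner ℝ n y| ^ τ - 2 * ρ ^ τ) /
      ‖y‖ ^ (((M + 1 : ℕ) : ℝ) + 2 * α) with hGdef
  -- As `u x = ρ ^ τ` exactly, the central terms cancel and the difference is the error at `y` plus
  -- the error at `-y`; the factor `1/2` in the fractional Laplacian compensates for the doubling.
  have hdiff : ∀ y, fracIntegrand α u x y - G y =
      flatError α τ u x n ρ y + flatError α τ u x n ρ (-y) := by
    intro y
    simp only [fracIntegrand, hGdef, flatError, inner_neg_right, norm_neg, hux, ← sub_eq_add_neg]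
    ring
  have hle : ‖∫ y, (fracIntegrand α u x y - G y)‖ₑ ≤ ENNReal.ofReal (b + b) := by
    refine (enorm_integral_le_lintegral_enorm _).trans ?_
    calc ∫⁻ y, ‖fracIntegrand α u x y - G y‖ₑ
        ≤ ∫⁻ y, (‖flatError α τ u x n ρ y‖ₑ + ‖flatError α τ u x n ρ (-y)‖ₑ) := by
          refine lintegral_mono fun y => ?_
          simp only [hdiff]
          exact enorm_add_le _ _
      _ = (∫⁻ y, ‖flatError α τ u x n ρ y‖ₑ) + ∫⁻ y, ‖flatError α τ u x n ρ (-y)‖ₑ :=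
          lintegral_add_left (measurable_flatError hum x n ρ).enorm _
      _ ≤ ENNReal.ofReal b + ENNReal.ofReal b := by
          rw [lintegral_neg_eq_self (fun y => ‖flatError α τ u x n ρ y‖ₑ)]
          exact add_le_add herr herr
      _ = _ := (ENNReal.ofReal_add hb hb).symm
  rw [integral_sub hui hGi, hG, ← ofReal_norm, ENNReal.ofReal_le_ofReal_iff (by linarith),
    Real.norm_eq_abs] at hle
  rw [fracLaplacian, abs_le]
  rw [abs_le] at hle
  constructor <;> linarith [hle.1, hle.2]

/-- Near `0` the second difference is `O(‖y‖²)`, which `α < 1` makes integrable; far away the kernel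
is bounded for the translates of `u` and integrable for the constant `u x`. -/
theorem integrable_fracIntegrand {M : ℕ} {α : ℝ} (hα : α ∈ Ioo (0 : ℝ) 1)
    {u : E (M + 1) → ℝ} (hum : Measurable u) (hui : Integrable u) {x : E (M + 1)}
    (hx : ContDiffAt ℝ 2 u x) : Integrable (fracIntegrand α u x) := by
  have hα0 := hα.1
  obtain ⟨K, hK, r, hr, hKr⟩ := exists_second_difference_bound hx
  set β : ℝ := ((M + 1 : ℕ) : ℝ) + 2 * α with hβ
  have hβ0 : 0 < β := by positivity
  have hm : Measurable (fracIntegrand α u x) := by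
    unfold fracIntegrand
    fun_prop
  rw [← integrableOn_univ, ← union_compl_self (Metric.ball (0 : E (M + 1)) r)]
  refine IntegrableOn.union ?_ ?_
  · refine integrableOn_ball_of_norm_le_rpow (C := K) (α := β - 2) (by simp)
      (by simp [hβ]; linarith [hα.2]) ?_ hm.aestronglyMeasurable
    filter_upwards [ae_restrict_mem Metric.isOpen_ball.measurableSet] with y hy
    rw [mem_ball_zero_iff] at hy
    rw [fracIntegrand, norm_div, Real.norm_of_nonneg (Real.rpow_nonneg (norm_nonneg y) _),
      Real.norm_eq_abs, ← hβ, neg_sub]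
    rcases (norm_nonneg y).eq_or_lt with h0 | h0
    · rw [← h0, Real.zero_rpow hβ0.ne', div_zero]
      positivity
    · rw [div_le_iff₀ (Real.rpow_pos_of_pos h0 _), mul_assoc, ← Real.rpow_add h0, sub_add_cancel,
        Real.rpow_two]
      exact hKr y hy
  · have i1 : Integrable fun y => r ^ (-β) * ‖u (x + y)‖ := (hui.comp_add_left x).norm.const_mul _
    have i2 : Integrable fun y => r ^ (-β) * ‖u (x - y)‖ := (hui.comp_sub_left x).norm.const_mul _
    have i3 : Integrable fun y : E (M + 1) =>
        2 * ‖u x‖ * ((r⁻¹ + 1) ^ β * (1 + ‖y‖) ^ (-β)) :=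
      ((integrable_one_add_norm (by simp [hβ, hα0])).const_mul _).const_mul _
    refine Integrable.mono' ((i1.add i2).add i3).integrableOn hm.aestronglyMeasurable ?_
    filter_upwards [ae_restrict_mem Metric.isOpen_ball.measurableSet.compl] with y hy
    have hyr : r ≤ ‖y‖ := by simpa using hy
    have hy0 : 0 < ‖y‖ := hr.trans_le hyr
    have h5 : ‖y‖ ^ (-β) ≤ r ^ (-β) :=
      Real.rpow_le_rpow_of_nonpos hr hyr (by linarith)
    have h6 : ‖y‖ ^ (-β) ≤ (r⁻¹ + 1) ^ β * (1 + ‖y‖) ^ (-β) := inv_add_one_rpow_le hr hyr hβ0.le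
    have h7 : ‖u (x + y) + u (x - y) - 2 * u x‖ ≤ ‖u (x + y)‖ + ‖u (x - y)‖ + 2 * ‖u x‖ := by
      refine (norm_sub_le _ _).trans (add_le_add (norm_add_le _ _) (le_of_eq ?_))
      rw [norm_mul, Real.norm_two]
    rw [fracIntegrand, norm_div, Real.norm_of_nonneg (Real.rpow_nonneg (norm_nonneg y) _),
      div_eq_mul_inv, ← Real.rpow_neg hy0.le, ← hβ]
    have h8 : 0 ≤ ‖y‖ ^ (-β) := by positivity
    calc _ ≤ (‖u (x + y)‖ + ‖u (x - y)‖ + 2 * ‖u x‖) * ‖y‖ ^ (-β) := by gcongr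
      _ = ‖y‖ ^ (-β) * ‖u (x + y)‖ + ‖y‖ ^ (-β) * ‖u (x - y)‖ + 2 * ‖u x‖ * ‖y‖ ^ (-β) := by ring
      _ ≤ _ := by
        exact add_le_add (add_le_add (mul_le_mul_of_nonneg_right h5 (norm_nonneg _))
          (mul_le_mul_of_nonneg_right h5 (norm_nonneg _)))
          (mul_le_mul_of_nonneg_left h6 (by positivity))

/-- A function with a flat expansion at a point of the hypersurface is integrable near it. -/
theorem HasFlatExpansion.integrableAtFilter {M : ℕ} {τ K r : ℝ} (hτ : τ ∈ Ioo (-1 : ℝ) 0)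
    (hK : 0 ≤ K) (hr : 0 < r) {u : E (M + 1) → ℝ} (hum : Measurable u) {x n : E (M + 1)}
    (hn : ‖n‖ = 1) (h : HasFlatExpansion τ K r u x n 0) : IntegrableAtFilter u (𝓝 x) := by
  refine ⟨Metric.ball x r, Metric.ball_mem_nhds x hr, hum.aestronglyMeasurable, ?_⟩
  obtain ⟨ι, hι, hemb, hmp⟩ := exists_frame hn
  set a := r + K * r ^ 2 with ha
  set q : ℝ → ENNReal := (Ioo (-a) a).indicator fun s => ENNReal.ofReal (3 * |s| ^ τ) with hq
  have hqfin : ∫⁻ s, q s ≠ ⊤ := by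
    rw [hq, lintegral_indicator measurableSet_Ioo]
    have := ((integrableOn_abs_rpow hτ.1 a).const_mul 3).lintegral_lt_top
    exact this.ne
  have hpt : ∀ v : E M, ∫⁻ t : ℝ, (Metric.ball x r).indicator (fun y => ‖u y‖ₑ)
      (x + (t • n + ι v)) ≤ (Metric.ball (0 : E M) r).indicator (fun _ => ∫⁻ s, q s) v := by
    intro v
    rcases le_or_gt r ‖v‖ with hv | hv
    · have : ∀ t : ℝ, (Metric.ball x r).indicator (fun y => ‖u y‖ₑ) (x + (t • n + ι v)) = 0 :=
        fun t => by
          refine indicator_of_notMem (fun h => ?_) _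
          rw [mem_ball_iff_norm, add_sub_cancel_left] at h
          linarith [norm_le_norm_smul_add hn hι t v]
      simp [this]
    · rw [indicator_of_mem (by simpa using hv)]
      obtain ⟨s₀, hs₀, hexp⟩ := h (ι v) (hι v) (by rwa [ι.norm_map])
      rw [ι.norm_map] at hs₀
      rw [← lintegral_sub_right_eq_self q s₀]
      refine lintegral_mono_ae ?_
      filter_upwards [Measure.ae_ne volume s₀] with t ht
      by_cases hmem : x + (t • n + ι v) ∈ Metric.ball x r
      swap
      · rw [indicator_of_notMem hmem]
        exact zero_le
      rw [indicator_of_mem hmem]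
      rw [mem_ball_iff_norm, add_sub_cancel_left] at hmem
      have htr : |t| < r := (abs_le_norm_smul_add hn hι t v).trans_lt hmem
      obtain ⟨δ, h1, -, h3⟩ := hexp t htr
      rw [zero_add] at h3
      have hpos : 0 < |t - s₀| := abs_pos.2 (sub_ne_zero.2 ht)
      have hin : t - s₀ ∈ Ioo (-a) a := by
        refine abs_lt.1 ((abs_sub t s₀).trans_lt ?_)
        have : K * ‖v‖ ^ 2 ≤ K * r ^ 2 := by gcongr
        linarith
      rw [hq, indicator_of_mem hin, h1, ← ofReal_norm]
      refine ENNReal.ofReal_le_ofReal ?_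
      have hδ0 : 0 ≤ δ := by linarith
      rw [Real.norm_of_nonneg (Real.rpow_nonneg hδ0 _)]
      exact rpow_le_three_mul_rpow hτ hpos h3
  have hm : Measurable fun y => (Metric.ball x r).indicator (fun y => ‖u y‖ₑ) (x + y) :=
    (hum.enorm.indicator Metric.isOpen_ball.measurableSet).comp (measurable_const_add x)
  rw [hasFiniteIntegral_iff_enorm, ← lintegral_indicator Metric.isOpen_ball.measurableSet,
    ← lintegral_add_left_eq_self _ x, lintegral_frame hemb hmp hm]
  refine (lintegral_mono hpt).trans_lt ?_
  rw [lintegral_indicator Metric.isOpen_ball.measurableSet, setLIntegral_const]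
  exact ENNReal.mul_lt_top hqfin.lt_top measure_ball_lt_top

/-! ### The function `V_τ` -/

/-- Without `𝒞`, the connected set `Ω` would be split by `Ω₁` and `Ω₂`. -/
theorem IsSetting.nonempty {N : ℕ} {Ω 𝒞 Ω₁ Ω₂ : Set (E N)} (h : IsSetting Ω 𝒞 Ω₁ Ω₂) :
    𝒞.Nonempty := by
  by_contra hne
  rw [not_nonempty_iff_eq_empty] at hne
  have hu := h.union
  rw [hne, sdiff_empty] at hu
  obtain ⟨x₁, h₁⟩ := h.isConnected_inner.nonempty
  obtain ⟨x₂, h₂⟩ := h.isConnected_outer.nonempty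
  obtain ⟨z, -, hz⟩ := h.isConnected.isPreconnected Ω₁ Ω₂ h.isOpen_inner h.isOpen_outer hu.ge
    ⟨x₁, hu ▸ Or.inl h₁, h₁⟩ ⟨x₂, hu ▸ Or.inr h₂, h₂⟩
  exact disjoint_left.1 h.disjoint hz.1 hz.2

/-- A single point cannot carry two disjoint nonempty sets. This permits writing `N = M + 1` and
separating a normal direction. -/
theorem IsSetting.ne_zero {N : ℕ} {Ω 𝒞 Ω₁ Ω₂ : Set (E N)} (h : IsSetting Ω 𝒞 Ω₁ Ω₂) : N ≠ 0 := by
  rintro rfl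
  obtain ⟨x₁, h₁⟩ := h.isConnected_inner.nonempty
  obtain ⟨x₂, h₂⟩ := h.isConnected_outer.nonempty
  rw [Subsingleton.elim x₂ x₁] at h₂
  exact disjoint_left.1 h.disjoint h₁ h₂

section

variable {N : ℕ} {Ω 𝒞 : Set (E N)} {δ τ : ℝ} {l : E N → ℝ}

theorem V_eq_zero_of_notMem {x : E N} (hx : x ∉ Ω) : V Ω 𝒞 δ l τ x = 0 := by
  have h1 : x ∉ A Ω 𝒞 δ := fun h => hx h.1
  have h2 : x ∉ B Ω δ := fun h => hx h.1
  simp [V, h1, h2, hx]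

theorem measurable_V (hΩ : IsOpen Ω) (h𝒞 : IsCompact 𝒞) (hsub : 𝒞 ⊆ Ω) (hδ : 0 < δ) (hτ : τ ≠ 0)
    (hl : IsAdmissible Ω 𝒞 δ τ l) : Measurable (V Ω 𝒞 δ l τ) := by
  classical
  have e : V Ω 𝒞 δ l τ = (Ω \ 𝒞).piecewise (V Ω 𝒞 δ l τ) 0 := by
    funext x
    by_cases hx : x ∈ Ω \ 𝒞
    · rw [piecewise_eq_of_mem _ _ _ hx]
    rw [piecewise_eq_of_notMem _ _ _ hx]
    by_cases hxΩ : x ∈ Ω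
    · have hx𝒞 : x ∈ 𝒞 := by
        by_contra h
        exact hx ⟨hxΩ, h⟩
      have hD : D 𝒞 x = 0 := Metric.infDist_zero_of_mem hx𝒞
      have hA : x ∈ A Ω 𝒞 δ := ⟨hsub hx𝒞, by rw [hD]; exact hδ⟩
      -- On `𝒞` the value is `0 ^ τ = 0`, so `V` is continuous on the open set `Ω \ 𝒞` and zero
      -- elsewhere.
      rw [V, if_pos hA, hD, Real.zero_rpow hτ]
      rfl
    · exact V_eq_zero_of_notMem hxΩ
  rw [e]
  exact hl.contDiffOn.continuousOn.measurable_piecewise continuousOn_const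
    (hΩ.sdiff h𝒞.isClosed).measurableSet

theorem hasFlatExpansion_V {K r : ℝ} (hΩ : ∀ y, D 𝒞 y < 3 * r → y ∈ Ω) (hrδ : 3 * r ≤ δ)
    {x n : E N} (hx : D 𝒞 x < r) (hn : ‖n‖ = 1)
    (h : ∀ w, inner ℝ n w = 0 → ‖w‖ < r → ∃ s₀ : ℝ, |s₀| ≤ K * ‖w‖ ^ 2 ∧ ∀ t : ℝ, |t| < r →
        |Metric.infDist (x + w + t • n) 𝒞 - abs (Metric.infDist x 𝒞 + t)| ≤ K * ‖w‖ ^ 2 ∧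
        |Metric.infDist x 𝒞 + t - s₀| / 3 ≤ Metric.infDist (x + w + t • n) 𝒞) :
    HasFlatExpansion τ K r (V Ω 𝒞 δ l τ) x n (D 𝒞 x) := by
  intro w hw hwr
  obtain ⟨s₀, hs₀, hexp⟩ := h w hw hwr
  refine ⟨s₀, hs₀, fun t ht => ⟨D 𝒞 (x + w + t • n), ?_, hexp t ht⟩⟩
  have e : x + (t • n + w) = x + w + t • n := by abel
  have hlt : D 𝒞 (x + w + t • n) < 3 * r := by
    have h1 : D 𝒞 (x + w + t • n) ≤ D 𝒞 x + dist (x + w + t • n) x :=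
      Metric.infDist_le_infDist_add_dist
    have h2 : dist (x + w + t • n) x ≤ ‖w‖ + |t| := by
      rw [dist_eq_norm, show x + w + t • n - x = w + t • n by abel]
      refine (norm_add_le _ _).trans (le_of_eq ?_)
      rw [norm_smul, hn, mul_one, Real.norm_eq_abs]
    linarith
  rw [e, V, if_pos ⟨hΩ _ hlt, hlt.trans_le hrδ⟩]

end

/-- Local integrability suffices, the support lying in the compact closure of `Ω`. At `𝒞` it comes
from the expansion with `ρ = 0`, in `Ω \ 𝒞` from continuity, and at the boundary from `d² ≤ δ²`. -/
theorem integrable_V {M : ℕ} {Ω 𝒞 Ω₁ Ω₂ : Set (E (M + 1))} {δ τ K r : ℝ} {l : E (M + 1) → ℝ}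
    (hS : IsSetting Ω 𝒞 Ω₁ Ω₂) (hδ : IsCollarWidth Ω 𝒞 δ) (hτ : τ ∈ Ioo (-1 : ℝ) 0)
    (hl : IsAdmissible Ω 𝒞 δ τ l) (hK : 0 ≤ K) (hr : 0 < r)
    (hexp : ∀ x ∈ 𝒞, ∃ n, ‖n‖ = 1 ∧ HasFlatExpansion τ K r (V Ω 𝒞 δ l τ) x n 0) :
    Integrable (V Ω 𝒞 δ l τ) := by
  have hm := measurable_V hS.isOpen hS.isCompact hS.subset hδ.pos hτ.2.ne hl
  have hloc : LocallyIntegrable (V Ω 𝒞 δ l τ) := by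
    intro x
    by_cases hxΩ : x ∈ Ω
    · by_cases hx𝒞 : x ∈ 𝒞
      · obtain ⟨n, hn, h⟩ := hexp x hx𝒞
        exact h.integrableAtFilter hτ hK hr hm hn
      · have hopen : IsOpen (Ω \ 𝒞) := hS.isOpen.sdiff hS.isCompact.isClosed
        have := hl.contDiffOn.continuousOn.integrableAt_nhdsWithin (μ := volume)
          hopen.measurableSet ⟨hxΩ, hx𝒞⟩
        rwa [hopen.nhdsWithin_eq ⟨hxΩ, hx𝒞⟩] at this
    · by_cases hcl : x ∈ closure Ω
      · have hfr : x ∈ frontier Ω := ⟨hcl, by rwa [hS.isOpen.interior_eq]⟩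
        refine ⟨Metric.ball x δ, Metric.ball_mem_nhds x hδ.pos,
          Measure.integrableOn_of_bounded (M := δ ^ 2) measure_ball_lt_top.ne
            hm.aestronglyMeasurable ?_⟩
        filter_upwards [ae_restrict_mem Metric.isOpen_ball.measurableSet] with z hz
        by_cases hzΩ : z ∈ Ω
        · have hdz : d Ω z < δ := (Metric.infDist_le_dist_of_mem hfr).trans_lt hz
          have hB : z ∈ B Ω δ := ⟨hzΩ, hdz⟩
          -- `V` tests membership in `A` first; the positive distance between the collars excludes
          -- it here.
          have hA : z ∉ A Ω 𝒞 δ := fun hA => by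
            obtain ⟨ε, hε, h⟩ := hδ.separated
            have := h z hA z hB
            rw [dist_self] at this
            linarith
          have hd0 : 0 ≤ d Ω z := Metric.infDist_nonneg
          rw [V, if_neg hA, if_pos hB, Real.norm_of_nonneg (by positivity)]
          gcongr
        · rw [V_eq_zero_of_notMem hzΩ, norm_zero]
          positivity
      · refine ⟨(closure Ω)ᶜ, isClosed_closure.isOpen_compl.mem_nhds hcl, ?_⟩
        refine integrableOn_zero.congr_fun (fun z hz => ?_) isClosed_closure.measurableSet.compl
        exact (V_eq_zero_of_notMem fun h => hz (subset_closure h)).symm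
  have hcomp : IsCompact (closure Ω) := hS.isBounded.isCompact_closure
  refine (integrableOn_iff_integrable_of_support_subset fun z hz => ?_).1
    (hloc.integrableOn_isCompact hcomp)
  by_contra h
  exact hz (V_eq_zero_of_notMem fun h' => h (subset_closure h'))

/-- This is the asymptotic formula behind all three estimates: the flat main term, with an error
constant uniform in `x`. -/
theorem fracLaplacian_V_expansion {M : ℕ} {Ω 𝒞 Ω₁ Ω₂ : Set (E (M + 1))} {δ α τ : ℝ}
    {l : E (M + 1) → ℝ} (hS : IsSetting Ω 𝒞 Ω₁ Ω₂) (hδ : IsCollarWidth Ω 𝒞 δ)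
    (hα : α ∈ Ioo (0 : ℝ) 1) (hτ : τ ∈ Ioo (-1 : ℝ) 0) (hl : IsAdmissible Ω 𝒞 δ τ l) :
    (∀ x ∈ Ω \ 𝒞, Integrable (fracIntegrand α (V Ω 𝒞 δ l τ) x)) ∧
    ∃ C ≥ 0, ∃ r ∈ Ioc 0 δ, ∀ x ∈ A Ω 𝒞 r \ 𝒞, 0 < D 𝒞 x ∧
      |fracLaplacian α (V Ω 𝒞 δ l τ) x +
        kernelMass M (((M + 1 : ℕ) : ℝ) + 2 * α) * c α τ * D 𝒞 x ^ (τ - 2 * α)| ≤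
        C * D 𝒞 x ^ min τ (2 * τ - 2 * α + 1) := by
  have hne := hS.nonempty
  obtain ⟨K, hK, r₀, hr₀, hgeo⟩ := exists_infDist_expansion hS.isCompact hne
    (exists_isGraphAt_of_isCompact hS.isCompact fun p₀ hp₀ => by
      obtain ⟨U, φ, hU, hpU, hφ, hdφ, heq⟩ := hS.hypersurface p₀ hp₀
      exact exists_isGraphAt_of_level_set hU hpU hφ hdφ heq)
  obtain ⟨r₁, hr₁, hthick⟩ := hS.isCompact.exists_thickening_subset_open hS.isOpen hS.subset
  have hδ0 := hδ.pos
  -- Points reached by the expansion satisfy `D < 3 r`, so the thirds keep them in `Ω` and in the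
  -- collar; `1 / K` secures `K * D x ≤ 1`.
  set r := min (min r₀ (r₁ / 3)) (min (δ / 3) (min 1 (1 / K))) with hr
  have hr0 : 0 < r := by positivity
  have hrr₀ : r ≤ r₀ := (min_le_left _ _).trans (min_le_left _ _)
  have hrr₁ : r ≤ r₁ / 3 := (min_le_left _ _).trans (min_le_right _ _)
  have hrδ : r ≤ δ / 3 := (min_le_right _ _).trans (min_le_left _ _)
  have hr1 : r ≤ 1 := (min_le_right _ _).trans ((min_le_right _ _).trans (min_le_left _ _))
  have hrK : r ≤ 1 / K := (min_le_right _ _).trans ((min_le_right _ _).trans (min_le_right _ _))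
  have hΩ : ∀ y, D 𝒞 y < 3 * r → y ∈ Ω := fun y hy => by
    refine hthick ((Metric.mem_thickening_iff_infDist_lt hne).2 ?_)
    exact hy.trans_le (by linarith)
  have hexp : ∀ x, D 𝒞 x < r → ∃ n, ‖n‖ = 1 ∧
      HasFlatExpansion τ K r (V Ω 𝒞 δ l τ) x n (D 𝒞 x) := by
    intro x hx
    obtain ⟨n, hn, h⟩ := hgeo x (hx.trans_le hrr₀)
    refine ⟨n, hn, hasFlatExpansion_V hΩ (by linarith) hx hn fun w hw hwr => ?_⟩
    obtain ⟨s₀, hs₀, h'⟩ := h w hw (hwr.trans_le hrr₀)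
    exact ⟨s₀, hs₀, fun t ht => h' t (ht.trans_le hrr₀)⟩
  have hm := measurable_V hS.isOpen hS.isCompact hS.subset hδ0 hτ.2.ne hl
  have hi : Integrable (V Ω 𝒞 δ l τ) := by
    refine integrable_V hS hδ hτ hl hK.le hr0 fun x hx => ?_
    have hD : D 𝒞 x = 0 := Metric.infDist_zero_of_mem hx
    obtain ⟨n, hn, h⟩ := hexp x (by rw [hD]; exact hr0)
    rw [hD] at h
    exact ⟨n, hn, h⟩
  have hopen : IsOpen (Ω \ 𝒞) := hS.isOpen.sdiff hS.isCompact.isClosed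
  have hF : ∀ x ∈ Ω \ 𝒞, Integrable (fracIntegrand α (V Ω 𝒞 δ l τ) x) := fun x hx =>
    integrable_fracIntegrand hα hm hi (hl.contDiffOn.contDiffAt (hopen.mem_nhds hx))
  refine ⟨hF, ?_⟩
  obtain ⟨C, hC, herr⟩ := lintegral_flatError_le M hα hτ hK hr0 hr1 hm hi
  refine ⟨C, hC, r, ⟨hr0, by linarith⟩, fun x hx => ?_⟩
  have hxr : D 𝒞 x < r := hx.1.2
  have hD0 : 0 < D 𝒞 x := (hS.isCompact.isClosed.notMem_iff_infDist_pos hne).1 hx.2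
  refine ⟨hD0, ?_⟩
  obtain ⟨n, hn, h⟩ := hexp x hxr
  have hKD : K * D 𝒞 x ≤ 1 := by
    have : D 𝒞 x ≤ 1 / K := hxr.le.trans hrK
    rwa [le_div_iff₀' hK] at this
  have hVx : V Ω 𝒞 δ l τ x = D 𝒞 x ^ τ := by
    rw [V, if_pos ⟨hx.1.1, hxr.trans_le (by linarith)⟩]
  exact abs_fracLaplacian_add_le hα hτ hD0 hn hm (hF x ⟨hx.1.1, hx.2⟩) hVx (by positivity)
    (herr x n _ hn hD0 hxr.le hKD h)

/-! ### From the asymptotic formula to the stated bounds -/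

theorem two_sided_bound {a : ℝ} (ha : 0 < a) : ∃ K > (1 : ℝ), ∀ X P : ℝ, 0 ≤ P →
    |X - a * P| ≤ a / 2 * P → 1 / K * P ≤ X ∧ X ≤ K * P := by
  refine ⟨max 2 (max (2 / a) (2 * a)), lt_max_of_lt_left one_lt_two, fun X P hP h => ?_⟩
  set K := max 2 (max (2 / a) (2 * a)) with hK
  have h1 : 2 / a ≤ K := (le_max_left _ _).trans (le_max_right _ _)
  have h2 : 2 * a ≤ K := (le_max_right _ _).trans (le_max_right _ _)
  have h3 : 1 / K ≤ a / 2 := by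
    rw [one_div_le (by positivity) (by positivity), one_div_div]
    exact h1
  have h4 := abs_le.1 h
  have h5 : 1 / K * P ≤ a / 2 * P := by gcongr
  have h6 : 2 * a * P ≤ K * P := by gcongr
  constructor <;> nlinarith

theorem exists_small_radius {C θ a r : ℝ} (hC : 0 ≤ C) (hθ : 0 < θ) (ha : 0 < a) (hr : 0 < r) :
    ∃ r' ∈ Ioc 0 r, ∀ ρ : ℝ, 0 < ρ → ρ < r' → C * ρ ^ θ ≤ a := by
  set s := (a / (C + 1)) ^ (1 / θ) with hs
  have hs0 : 0 < s := by positivity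
  refine ⟨min r s, ⟨lt_min hr hs0, min_le_left _ _⟩, fun ρ hρ hρ' => ?_⟩
  have h1 : ρ ^ θ ≤ s ^ θ := Real.rpow_le_rpow hρ.le (hρ'.le.trans (min_le_right _ _)) hθ.le
  rw [hs, ← Real.rpow_mul (by positivity), one_div_mul_cancel hθ.ne', Real.rpow_one] at h1
  calc C * ρ ^ θ ≤ (C + 1) * (a / (C + 1)) := by
        gcongr
        linarith
    _ = a := by field_simp

end InteriorBlowUp

open InteriorBlowUp in
theorem mainTheorem4 :
    ∃ (α₀ : ℝ) (τ₁ : ℝ → ℝ), InteriorBlowUp.IsThreshold α₀ τ₁ ∧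
    ∀ (N : ℕ) (Ω 𝒞 Ω₁ Ω₂ : Set (InteriorBlowUp.E N)),
      InteriorBlowUp.IsSetting Ω 𝒞 Ω₁ Ω₂ →
    ∀ δ : ℝ, InteriorBlowUp.IsCollarWidth Ω 𝒞 δ →
    ∀ α τ : ℝ, α ∈ Set.Ioo (0 : ℝ) 1 → τ ∈ Set.Ioo (-1 : ℝ) 0 →
    ∀ l : InteriorBlowUp.E N → ℝ, InteriorBlowUp.IsAdmissible Ω 𝒞 δ τ l →
      -- the integral defining the fractional Laplacian of `V_τ` converges absolutely off `𝒞`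
      (∀ x ∈ Ω \ 𝒞, MeasureTheory.Integrable
        (InteriorBlowUp.fracIntegrand α (InteriorBlowUp.V Ω 𝒞 δ l τ) x)) ∧
      -- (i)
      ((α₀ ≤ α ∨ (α < α₀ ∧ τ < τ₁ α)) →
        ∃ δ₁ ∈ Set.Ioc 0 δ, ∃ K > (1 : ℝ), ∀ x ∈ InteriorBlowUp.A Ω 𝒞 δ₁ \ 𝒞,
          1 / K * InteriorBlowUp.D 𝒞 x ^ (τ - 2 * α)
              ≤ -InteriorBlowUp.fracLaplacian α (InteriorBlowUp.V Ω 𝒞 δ l τ) x ∧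
          -InteriorBlowUp.fracLaplacian α (InteriorBlowUp.V Ω 𝒞 δ l τ) x
              ≤ K * InteriorBlowUp.D 𝒞 x ^ (τ - 2 * α)) ∧
      -- (ii)
      ((α < α₀ ∧ τ₁ α < τ) →
        ∃ δ₁ ∈ Set.Ioc 0 δ, ∃ K > (1 : ℝ), ∀ x ∈ InteriorBlowUp.A Ω 𝒞 δ₁ \ 𝒞,
          1 / K * InteriorBlowUp.D 𝒞 x ^ (τ - 2 * α)
              ≤ InteriorBlowUp.fracLaplacian α (InteriorBlowUp.V Ω 𝒞 δ l τ) x ∧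
          InteriorBlowUp.fracLaplacian α (InteriorBlowUp.V Ω 𝒞 δ l τ) x
              ≤ K * InteriorBlowUp.D 𝒞 x ^ (τ - 2 * α)) ∧
      -- (iii)
      ((α < α₀ ∧ τ = τ₁ α) →
        ∃ δ₁ ∈ Set.Ioc 0 δ, ∃ K > (1 : ℝ), ∀ x ∈ InteriorBlowUp.A Ω 𝒞 δ₁ \ 𝒞,
          |InteriorBlowUp.fracLaplacian α (InteriorBlowUp.V Ω 𝒞 δ l τ) x|
              ≤ K * InteriorBlowUp.D 𝒞 x ^ min τ (2 * τ - 2 * α + 1)) := by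
  refine ⟨1 / 2, fun α => 2 * α - 1, isThreshold, ?_⟩
  intro N Ω 𝒞 Ω₁ Ω₂ hS δ hδ α τ hα hτ l hl
  obtain ⟨M, rfl⟩ := Nat.exists_eq_succ_of_ne_zero hS.ne_zero
  obtain ⟨hint, C, hC, r, hr, hexp⟩ := fracLaplacian_V_expansion hS hδ hα hτ hl
  set κ := kernelMass M (((M + 1 : ℕ) : ℝ) + 2 * α) with hκ
  have hκ0 : 0 < κ := kernelMass_pos (by push_cast; linarith [hα.1])
  -- The gap between the error exponent and the main exponent `τ - 2α`.
  set θ := min (2 * α) (τ + 1) with hθ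
  have hθ0 : 0 < θ := lt_min (by linarith [hα.1]) (by linarith [hτ.1])
  have hsplit : ∀ ρ : ℝ, 0 < ρ →
      ρ ^ min τ (2 * τ - 2 * α + 1) = ρ ^ θ * ρ ^ (τ - 2 * α) := fun ρ hρ => by
    rw [← Real.rpow_add hρ, hθ, ← min_add_add_right]
    ring_nf
  -- Applied with `a = |κ c|`, this makes the error at most half of the main term.
  have hbound : ∀ a : ℝ, 0 < a → ∃ δ₁ ∈ Set.Ioc 0 δ, ∀ x ∈ A Ω 𝒞 δ₁ \ 𝒞, 0 < D 𝒞 x ∧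
      |fracLaplacian α (V Ω 𝒞 δ l τ) x + κ * c α τ * D 𝒞 x ^ (τ - 2 * α)| ≤
        a / 2 * D 𝒞 x ^ (τ - 2 * α) := by
    intro a ha
    obtain ⟨r', hr', hsmall⟩ := exists_small_radius hC hθ0 (half_pos ha) hr.1
    refine ⟨r', ⟨hr'.1, hr'.2.trans hr.2⟩, fun x hx => ?_⟩
    obtain ⟨hD0, h⟩ := hexp x ⟨⟨hx.1.1, hx.1.2.trans_le hr'.2⟩, hx.2⟩
    refine ⟨hD0, h.trans ?_⟩
    rw [hsplit _ hD0, ← mul_assoc]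
    have := hsmall _ hD0 hx.1.2
    gcongr
  refine ⟨hint, fun hi => ?_, fun hii => ?_, fun hiii => ?_⟩
  · have hc : 0 < c α τ := by
      rcases hi with h | h
      · exact isThreshold.pos_of_ge α ⟨h, hα.2⟩ τ hτ
      · exact isThreshold.pos_of_lt α ⟨hα.1, h.1⟩ τ ⟨hτ.1, h.2⟩
    have ha : 0 < κ * c α τ := mul_pos hκ0 hc
    obtain ⟨δ₁, hδ₁, hb⟩ := hbound _ ha
    obtain ⟨K, hK, h2⟩ := two_sided_bound ha
    refine ⟨δ₁, hδ₁, K, hK, fun x hx => ?_⟩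
    obtain ⟨hD0, h⟩ := hb x hx
    refine h2 _ _ (Real.rpow_nonneg hD0.le _) ?_
    rwa [← abs_neg, neg_sub, sub_neg_eq_add, add_comm]
  · have hc : c α τ < 0 := isThreshold.neg_of_gt α ⟨hα.1, hii.1⟩ τ ⟨hii.2, hτ.2⟩
    have ha : 0 < -(κ * c α τ) := neg_pos.2 (mul_neg_of_pos_of_neg hκ0 hc)
    obtain ⟨δ₁, hδ₁, hb⟩ := hbound _ ha
    obtain ⟨K, hK, h2⟩ := two_sided_bound ha
    refine ⟨δ₁, hδ₁, K, hK, fun x hx => ?_⟩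
    obtain ⟨hD0, h⟩ := hb x hx
    refine h2 _ _ (Real.rpow_nonneg hD0.le _) ?_
    rwa [neg_mul, sub_neg_eq_add]
  · have hc : c α τ = 0 := by
      rw [hiii.2]
      exact isThreshold.zero α ⟨hα.1, hiii.1⟩
    -- Adding `2` to the nonnegative `C` ensures a constant greater than `1`.
    refine ⟨r, hr, C + 2, by linarith, fun x hx => ?_⟩
    obtain ⟨hD0, h⟩ := hexp x hx
    rw [hc, mul_zero, zero_mul, add_zero] at h
    refine h.trans ?_
    have := Real.rpow_nonneg hD0.le (min τ (2 * τ - 2 * α + 1))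
    nlinarith
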